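/- Let $M\subset\mathbb C^k$ be compact and let $m\ge 1$. For $1\le j\le m$ and $\lambda\in M$ let $p_{j,\lambda}$ be a monic polynomial of degree $d_j\ge 2$ (with $d_j$ independent of $\lambda$) and let $a_j(\lambda)\ne 0$, such that $a_j(\lambda)$ and the coefficients of $p_{j,\lambda}$ are continuous functions of $\lambda\in M$. Put $H_\lambda^{(j)}(x,y)=(y,\,p_{j,\lambda}(y)-a_j(\lambda)x)$, $H_\lambda=H_\lambda^{(m)}\circ\cdots\circ H_\lambda^{(1)}$ on $\mathbb C^2$, and $d=d_1\cdots d_m$. Let $X=M\times M\times\cdots$ with the product topology. For $\Lambda=(\lambda_1,\lambda_2,\dots)\in X$, $\lambda\in M$ and $n\ge 0$ let $\lambda\Lambda=(\lambda,\lambda_1,\lambda_2,\dots)$, $$H^{\pm}_{n,\Lambda}=H_{\lambda_n}^{\pm1}\circ\cdots\circ H_{\lambda_1}^{\pm1},\qquad G^{\pm}_{n,\Lambda}(z)=\frac1{d^n}\log^+\|H^{\pm}_{n,\Lambda}(z)\|,$$ where $\log^+t=\max\{\log t,0\}$ (so $\log^+0=0$) and $\|\cdot\|$ is the Euclidean norm,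 and let $$I^\pm_\Lambda=\{z\in\mathbb C^2:\|H^\pm_{n,\Lambda}(z)\|\to\infty\text{ as }n\to\infty\},\qquad K^\pm_\Lambda=\{z\in\mathbb C^2:(H^\pm_{n,\Lambda}(z))_{n\ge0}\text{ is bounded}\}.$$ Then, for each choice of the sign $\pm$: 1. For each $\Lambda\in X$, the sequence $G^\pm_{n,\Lambda}$ converges locally uniformly on $\mathbb C^2$, as $n\to\infty$, to a nonnegative plurisubharmonic function $G^\pm_\Lambda$ which is locally Hölder continuous, that is, for some exponent $\beta\in(0,1]$ it is $\beta$-Hölder continuous on every compact subset of $\mathbb C^2$. 2. For all $\lambda\in M$ and $\Lambda\in X$, $G^\pm_\Lambda\circ H_\lambda^{\pm1}=d\,G^\pm_{\lambda\Lambda}$. 3. For each $\Lambda\in X$, $I^\pm_\Lambda=\mathbb C^2\setminus K^\pm_\Lambda$; the function $G^\pm_\Lambda$ is positive and pluriharmonic on $I^\pm_\Lambda$, and it vanishes precisely on $K^\pm_\Lambda$. 4. There is $C>0$ such that $0\le G^\pm_\Lambda(z)\le\log^+\|z\|+C$ for all $\Lambda\in X$ and $z\in\mathbb C^2$. 5.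 The map $\Lambda\mapsto G^\pm_\Lambda$ is continuous from $X$ to the space of continuous real-valued functions on $\mathbb C^2$ with the topology of locally uniform convergence. -/

import Mathlib

open Filter Topology Polynomial Real

/-- The space `ℂ²` with its Euclidean norm; `z 0` and `z 1` are the coordinates `x` and `y`. -/
abbrev C2 : Type := EuclideanSpace ℂ (Fin 2)

/-- The generalized Hénon map `(x, y) ↦ (y, p(y) - a x)` with `a ≠ 0`, as a bijection of `ℂ²`;
the inverse is `(x, y) ↦ ((p(x) - y) / a, x)`. -/
noncomputable def henonMap (p : ℂ[X]) (a : ℂ) (ha : a ≠ 0) : Equiv.Perm C2 where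
  toFun z := !₂[z 1, p.eval (z 1) - a * z 0]
  invFun z := !₂[(p.eval (z 0) - z 1) / a, z 0]
  left_inv z := by
    ext i
    fin_cases i <;> simp [ha]
  right_inv z := by
    ext i
    fin_cases i <;> simp [mul_div_cancel₀, ha]

/-- The composition `f_m ∘ ⋯ ∘ f_1` of finitely many bijections (the one of index `0` acts
first). -/
def composeAll {E : Type*} : (m : ℕ) → (Fin m → Equiv.Perm E) → Equiv.Perm E
  | 0, _ => 1
  | m + 1, f => f (Fin.last m) * composeAll m (fun j => f j.castSucc)

/-- The data of a continuous family of compositions of `m` generalized Hénon maps, with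
parameter in `M`: monic polynomials `p j l` of degree `deg j ≥ 2`, independent of the parameter
`l`, and nonzero numbers `a j l`, such that the `a j l` and the coefficients of the `p j l` are
continuous in `l`. -/
structure HenonFamily (M : Type*) [TopologicalSpace M] (m : ℕ) where
  p : Fin m → M → ℂ[X]
  a : Fin m → M → ℂ
  deg : Fin m → ℕ
  two_le_deg : ∀ j, 2 ≤ deg j
  monic : ∀ j l, (p j l).Monic
  natDegree_eq : ∀ j l, (p j l).natDegree = deg j
  continuous_coeff : ∀ j i, Continuous fun l => (p j l).coeff i
  a_ne_zero : ∀ j l, a j l ≠ 0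
  continuous_a : ∀ j, Continuous (a j)

namespace HenonFamily

variable {M : Type*} [TopologicalSpace M] {m : ℕ} (F : HenonFamily M m)

/-- The map `H_l = H_l^{(m)} ∘ ⋯ ∘ H_l^{(1)}`. -/
noncomputable def map (l : M) : Equiv.Perm C2 :=
  composeAll m fun j => henonMap (F.p j l) (F.a j l) (F.a_ne_zero j l)

/-- The degree `d = d_1 ⋯ d_m`. -/
def degree : ℕ := ∏ j, F.deg j

/-- The random iterate `H_{l_n}^ε ∘ ⋯ ∘ H_{l_1}^ε`, where `ε = ±1` and the sequence
`L = (l_1, l_2, …)` is indexed from `0`, that is `L 0 = l_1`. -/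
noncomputable def iter (ε : ℤˣ) (L : ℕ → M) : ℕ → Equiv.Perm C2
  | 0 => 1
  | n + 1 => F.map (L n) ^ (ε : ℤ) * iter ε L n

/-- The function `d⁻ⁿ log⁺ ‖H_{n,L}^ε‖`. -/
noncomputable def greenApprox (ε : ℤˣ) (L : ℕ → M) (n : ℕ) (z : C2) : ℝ :=
  1 / (F.degree : ℝ) ^ n * log⁺ ‖F.iter ε L n z‖

/-- The set of escaping points. -/
def escapingSet (ε : ℤˣ) (L : ℕ → M) : Set C2 :=
  {z | Tendsto (fun n => ‖F.iter ε L n z‖) atTop atTop}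

/-- The set of points with bounded orbit. -/
def boundedSet (ε : ℤˣ) (L : ℕ → M) : Set C2 :=
  {z | Bornology.IsBounded (Set.range fun n => F.iter ε L n z)}

end HenonFamily

/-- The sequence `(l, l_1, l_2, …)`. -/
def prependParam {M : Type*} (l : M) (L : ℕ → M) : ℕ → M
  | 0 => l
  | n + 1 => L n

/-- A function is locally Hölder continuous if, for some exponent in `(0, 1]`, it is Hölder
continuous with that exponent on every compact set. -/
def IsLocallyHolder (u : C2 → ℝ) : Prop :=
  ∃ β : NNReal, 0 < β ∧ β ≤ 1 ∧ ∀ K : Set C2, IsCompact K → ∃ C : NNReal, HolderOnWith C β u K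

/-- A real-valued function on `ℂ²` is plurisubharmonic if it is upper semicontinuous and satisfies
the sub-mean value inequality on every disc `ζ ↦ a + ζ b`, `|ζ| ≤ 1`, of a complex line. As
`u a ≠ -∞`, the inequality includes that `u` is integrable on the boundary circle. -/
def IsPlurisubharmonic (u : C2 → ℝ) : Prop :=
  UpperSemicontinuous u ∧
    ∀ a b : C2, CircleIntegrable (fun ζ : ℂ => u (a + ζ • b)) 0 1 ∧
      u a ≤ circleAverage (fun ζ : ℂ => u (a + ζ • b)) 0 1

/-- A function is pluriharmonic on a set if near every point of the set it is twice continuously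
differentiable and its restrictions to complex lines are harmonic. -/
def IsPluriharmonicOn (u : C2 → ℝ) (s : Set C2) : Prop :=
  ∀ a ∈ s, ContDiffAt ℝ 2 u a ∧
    ∀ᶠ c in 𝓝 a, ∀ b : C2, InnerProductSpace.HarmonicAt (fun ζ : ℂ => u (c + ζ • b)) 0

/-! The dynamics is governed by one dominant coordinate, `y` for forward and `x` for backward
iteration. In it both a Hénon map and its inverse read `g z i = q (z i) - b * z i.rev`, `g z i.rev =
z i` with `deg q ≥ 2`; for the inverse `q = a⁻¹ p` and `b = a⁻¹`. By compactness of `M` all bounds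
on `q` and `b` are uniform. For large `R` the region `horn i R` is mapped into itself and there `g z
i = z i ^ d * exp (ℓ z)` with `ℓ` holomorphic and bounded; a point whose image lies outside the horn
has its size at least halved, until it falls below `R`. These properties, collected in `IsEscaping`,
survive composition (`IsEscaping.comp`), so the rest concerns an arbitrary sequence of escaping maps
with common constants.

Off the horn sizes stay bounded by the initial one, and on it `log size` is multiplied by `d` up to
an error `C`. Hence `d⁻ⁿ log (size)` is Cauchy at geometric rate, with a bound depending only on the
size of the starting point (`exists_isGreen`). This uniformity gives local uniform convergence
jointly in the sequence and the point, hence continuity in both, and the logarithmic growth bound.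
An orbit either enters the horn and escapes, with positive limit, or remains bounded, with limit
zero.

Plurisubharmonicity is inherited from `log⁺ ‖f‖`. Where the orbit enters the horn, iterating the
formula for `g z i` writes the limit as `log |y|` plus the real part of a uniformly convergent
holomorphic series (`exists_eventuallyEq_re`). For Hölder continuity, the chain rule shows that a
smoothed `log⁺ ‖orbit‖` has Lipschitz constant `O(Bⁿ)` while it approximates `dⁿ G` to `O(1)`;
interpolation gives the exponent `log d / log B`. The halving off the horn makes `B` independent of
the compact set. -/

open scoped ContDiff

/-! ### Cauchy estimates and uniform limits of holomorphic maps. -/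

/-- Cauchy's estimate for the Fréchet derivative. -/
theorem norm_fderiv_le_of_forall_ball_norm_le {E F : Type*} [NormedAddCommGroup E]
    [NormedSpace ℂ E] [NormedAddCommGroup F] [NormedSpace ℂ F] {f : E → F} {x : E} {r B : ℝ}
    (hr : 0 < r) (hf : DifferentiableOn ℂ f (Metric.ball x r))
    (hB : ∀ z ∈ Metric.ball x r, ‖f z‖ ≤ B) : ‖fderiv ℂ f x‖ ≤ 2 * B / r := by
  have hB0 : 0 ≤ B := (norm_nonneg _).trans (hB x (Metric.mem_ball_self hr))
  refine ContinuousLinearMap.opNorm_le_bound _ (by positivity) fun v => ?_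
  rcases eq_or_ne v 0 with rfl | hv
  · simp
  have hv' : 0 < ‖v‖ := norm_pos_iff.2 hv
  -- The closed disc of this radius along `v` reaches only half-way to the boundary of the ball,
  -- whence the factor 2 in the bound.
  set s : ℝ := r / (2 * ‖v‖) with hs
  have hs0 : 0 < s := by positivity
  have hmem : ∀ ζ ∈ Metric.closedBall (0 : ℂ) s, x + ζ • v ∈ Metric.ball x r := by
    intro ζ hζ
    rw [mem_closedBall_zero_iff] at hζ
    rw [mem_ball_iff_norm, add_sub_cancel_left, norm_smul]
    calc ‖ζ‖ * ‖v‖ ≤ s * ‖v‖ := by gcongr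
      _ = r / 2 := by rw [hs]; field_simp
      _ < r := by linarith
  have hline : ∀ ζ : ℂ, HasDerivAt (fun ζ : ℂ => x + ζ • v) v ζ := fun ζ => by
    simpa using ((hasDerivAt_id ζ).smul_const v).const_add x
  have hder : ∀ ζ ∈ Metric.closedBall (0 : ℂ) s,
      HasDerivAt (fun ζ : ℂ => f (x + ζ • v)) (fderiv ℂ f (x + ζ • v) v) ζ := fun ζ hζ =>
    ((hf.differentiableAt (Metric.isOpen_ball.mem_nhds (hmem ζ hζ))).hasFDerivAt).comp_hasDerivAt ζ
      (hline ζ)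
  have h := Complex.norm_deriv_le_of_forall_mem_sphere_norm_le (c := 0) (R := s) (C := B)
    (f := fun ζ : ℂ => f (x + ζ • v)) hs0
    ((DifferentiableOn.diffContOnCl_ball fun ζ hζ =>
      (hder ζ hζ).differentiableAt.differentiableWithinAt) subset_rfl) fun ζ hζ =>
        hB _ (hmem ζ (Metric.sphere_subset_closedBall hζ))
  rw [(hder 0 (Metric.mem_closedBall_self hs0.le)).deriv] at h
  simp only [zero_smul, add_zero] at h
  refine h.trans_eq ?_
  rw [hs]
  field_simp

/-- On a smaller ball, the derivatives of a uniformly Cauchy sequence of holomorphic maps form a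
uniformly Cauchy sequence. -/
theorem UniformCauchySeqOn.complex_fderiv {E F : Type*} [NormedAddCommGroup E]
    [NormedSpace ℂ E] [NormedAddCommGroup F] [NormedSpace ℂ F] {f : ℕ → E → F} {x : E}
    {r s : ℝ} (hs : s < r) (hf : ∀ n, DifferentiableOn ℂ (f n) (Metric.ball x r))
    (hc : UniformCauchySeqOn f atTop (Metric.ball x r)) :
    UniformCauchySeqOn (fun n => fderiv ℂ (f n)) atTop (Metric.ball x s) := by
  rw [Metric.uniformCauchySeqOn_iff] at hc ⊢
  intro ε hε
  have hrs : 0 < r - s := sub_pos.2 hs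
  obtain ⟨N, hN⟩ := hc (ε * (r - s) / 4) (by positivity)
  refine ⟨N, fun m hm n hn z hz => ?_⟩
  have hsub : Metric.ball z (r - s) ⊆ Metric.ball x r := by
    refine Metric.ball_subset_ball' ?_
    have := Metric.mem_ball.1 hz
    linarith
  have hz' : z ∈ Metric.ball x r := Metric.ball_subset_ball hs.le hz
  have hd := fun n => (hf n).differentiableAt (Metric.isOpen_ball.mem_nhds hz')
  have hsum : fderiv ℂ (f m - f n) z = fderiv ℂ (f m) z - fderiv ℂ (f n) z :=
    fderiv_sub (hd m) (hd n)
  rw [dist_eq_norm, ← hsum]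
  have := norm_fderiv_le_of_forall_ball_norm_le (f := f m - f n) hrs
    (((hf m).sub (hf n)).mono hsub)
    (fun w hw => by simpa [dist_eq_norm] using (hN m hm n hn w (hsub hw)).le)
  refine this.trans_lt ?_
  rw [div_lt_iff₀ hrs]
  nlinarith [mul_pos hε hrs]

/-- A uniform limit of smooth holomorphic maps on a ball is smooth on smaller balls. -/
theorem contDiffOn_of_uniformCauchySeqOn {E : Type} [NormedAddCommGroup E] [NormedSpace ℂ E]
    {x : E} (k : ℕ) : ∀ {F : Type} [NormedAddCommGroup F] [NormedSpace ℂ F]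
    [CompleteSpace F] {f : ℕ → E → F} {g : E → F} {r s : ℝ}, s < r →
    (∀ n, ContDiffOn ℂ ∞ (f n) (Metric.ball x r)) →
    UniformCauchySeqOn f atTop (Metric.ball x r) →
    (∀ z ∈ Metric.ball x r, Tendsto (fun n => f n z) atTop (𝓝 (g z))) →
    ContDiffOn ℂ k g (Metric.ball x s) := by
  -- `F` stays quantified, since the induction hypothesis is applied to the derivatives, whose
  -- values lie in `E →L[ℂ] F`.
  induction k with
  | zero =>
    intro F _ _ _ f g r s hs hf hc hg
    have := (hc.tendstoUniformlyOn_of_tendsto hg).continuousOn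
      (Frequently.of_forall fun n => (hf n).continuousOn)
    exact contDiffOn_zero.2 (this.mono (Metric.ball_subset_ball hs.le))
  | succ k ih =>
    intro F _ _ _ f g r s hs hf hc hg
    -- Half of the gap `r - s` is spent on Cauchy's estimate, the other half on the induction
    -- hypothesis.
    have hst : s < (r + s) / 2 := by linarith
    have htr : (r + s) / 2 < r := by linarith
    have hfd : ∀ n, DifferentiableOn ℂ (f n) (Metric.ball x r) := fun n =>
      (hf n).differentiableOn (by simp)
    have hc' := hc.complex_fderiv htr hfd
    have hlim : ∀ z, ∃ l, z ∈ Metric.ball x ((r + s) / 2) →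
        Tendsto (fun n => fderiv ℂ (f n) z) atTop (𝓝 l) := by
      intro z
      by_cases hz : z ∈ Metric.ball x ((r + s) / 2)
      · obtain ⟨l, hl⟩ := cauchySeq_tendsto_of_complete (hc'.cauchySeq hz)
        exact ⟨l, fun _ => hl⟩
      · exact ⟨0, fun h => absurd h hz⟩
    choose g' hg' using hlim
    have hder : ∀ z ∈ Metric.ball x ((r + s) / 2), HasFDerivAt g (g' z) z := fun z hz =>
      hasFDerivAt_of_tendstoUniformlyOn Metric.isOpen_ball
        (hc'.tendstoUniformlyOn_of_tendsto hg')
        (fun n w hw => ((hfd n).differentiableAt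
          (Metric.isOpen_ball.mem_nhds (Metric.ball_subset_ball htr.le hw))).hasFDerivAt)
        (fun w hw => hg w (Metric.ball_subset_ball htr.le hw)) hz
    have hsub : Metric.ball x s ⊆ Metric.ball x ((r + s) / 2) := Metric.ball_subset_ball hst.le
    have hk := ih hst (fun n => ((hf n).mono (Metric.ball_subset_ball htr.le)).fderiv_of_isOpen
      Metric.isOpen_ball (m := ∞) (by simp)) hc' hg'
    push_cast
    rw [contDiffOn_succ_iff_fderiv_of_isOpen Metric.isOpen_ball]
    exact ⟨fun z hz => (hder z (hsub hz)).differentiableAt.differentiableWithinAt,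
      by simp, hk.congr fun z hz => (hder z (hsub hz)).fderiv⟩

/-! ### Plurisubharmonic and pluriharmonic functions. -/

/-- The sub-mean value inequality for `log ‖f‖`, `f` entire. -/
theorem log_norm_le_circleAverage {f : ℂ → ℂ} (hf : Differentiable ℂ f) (h0 : f 0 ≠ 0) :
    log ‖f 0‖ ≤ circleAverage (fun ζ => log ‖f ζ‖) 0 1 := by
  have han : AnalyticOnNhd ℂ f (Metric.closedBall 0 |1|) := fun z _ => hf.analyticAt z
  -- Jensen's formula: the excess of the average is a sum of `log (1 / |u|)` over the zeros `u` in
  -- the disc.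
  rw [han.circleAverage_log_norm one_ne_zero h0]
  refine le_add_of_nonneg_left (finsum_nonneg fun u => ?_)
  by_cases hu : u ∈ Metric.closedBall (0 : ℂ) |1|
  · refine mul_nonneg (by exact_mod_cast MeromorphicOn.AnalyticOnNhd.divisor_nonneg han u) ?_
    rw [mem_closedBall_zero_iff, abs_one] at hu
    rcases eq_or_ne u 0 with rfl | hu0
    · simp
    · refine log_nonneg ?_
      rw [zero_sub, norm_neg, one_mul]
      exact (one_le_inv₀ (norm_pos_iff.2 hu0)).2 hu
  · rw [Function.locallyFinsuppWithin.apply_eq_zero_of_notMem _ hu]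
    simp

/-- The sub-mean value inequality for `log⁺ ‖f‖`, `f` an entire map to a Hilbert space. -/
theorem posLog_norm_le_circleAverage {E : Type*} [NormedAddCommGroup E] [InnerProductSpace ℂ E]
    {f : ℂ → E} (hf : Differentiable ℂ f) :
    log⁺ ‖f 0‖ ≤ circleAverage (fun ζ => log⁺ ‖f ζ‖) 0 1 := by
  have hcont : Continuous fun ζ => log⁺ ‖f ζ‖ := continuous_posLog.comp hf.continuous.norm
  have hint : CircleIntegrable (fun ζ => log⁺ ‖f ζ‖) 0 1 := hcont.continuousOn.circleIntegrable'
  rcases le_or_gt ‖f 0‖ 1 with h1 | h1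
  · rw [(posLog_eq_zero_iff _).2 (by simpa using h1)]
    exact circleAverage_nonneg_of_nonneg fun _ _ => posLog_nonneg
  -- Pairing with the unit vector along `f 0` reduces to a scalar function that is dominated by
  -- `‖f‖` and agrees with it in norm at `0`.
  set w : E := ((‖f 0‖⁻¹ : ℝ) : ℂ) • f 0 with hw
  have hpos : 0 < ‖f 0‖ := by linarith
  have hw1 : ‖w‖ = 1 := by
    rw [hw, norm_smul, Complex.norm_real, norm_inv, norm_norm, inv_mul_cancel₀ hpos.ne']
  set h : ℂ → ℂ := fun ζ => inner ℂ w (f ζ)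
  have hle : ∀ ζ, ‖h ζ‖ ≤ ‖f ζ‖ := fun ζ => by
    simpa [hw1] using norm_inner_le_norm (𝕜 := ℂ) w (f ζ)
  have h0 : ‖h 0‖ = ‖f 0‖ := by
    simp only [h, hw, inner_smul_left, inner_self_eq_norm_sq_to_K]
    simp
    field_simp
  have hd : Differentiable ℂ h := fun ζ => ((innerSL ℂ w).differentiableAt).comp ζ (hf ζ)
  have hne : h 0 ≠ 0 := norm_pos_iff.1 (h0 ▸ hpos)
  rw [posLog_eq_log (by simpa using h1.le), ← h0]
  refine (log_norm_le_circleAverage hd hne).trans (circleAverage_mono ?_ hint fun ζ _ => ?_)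
  · exact MeromorphicOn.circleIntegrable_log_norm fun z _ => (hd.analyticAt z).meromorphicAt
  · calc log ‖h ζ‖ ≤ log⁺ ‖h ζ‖ := le_max_right _ _
      _ ≤ log⁺ ‖f ζ‖ := posLog_le_posLog (norm_nonneg _) (hle ζ)

/-- The real part of a twice continuously differentiable holomorphic function, up to an additive
constant, is `C²` and harmonic on complex lines. -/
theorem IsPluriharmonicOn.of_eventuallyEq_re {u : C2 → ℝ} {s : Set C2}
    (h : ∀ a ∈ s, ∃ (Φ : C2 → ℂ) (c : ℝ), ContDiffAt ℂ 2 Φ a ∧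
      u =ᶠ[𝓝 a] fun z => c + (Φ z).re) : IsPluriharmonicOn u s := by
  intro a ha
  obtain ⟨Φ, c, hΦ, hu⟩ := h a ha
  constructor
  · refine ContDiffAt.congr_of_eventuallyEq ?_ hu
    exact contDiffAt_const.add (Complex.reCLM.contDiff.contDiffAt.comp a (hΦ.restrict_scalars ℝ))
  · filter_upwards [hΦ.eventually (by simp), hu.eventuallyEq_nhds] with z hz huz b
    have hline : ContDiffAt ℂ 2 (fun ζ : ℂ => z + ζ • b) 0 := by fun_prop
    have ht : Tendsto (fun ζ : ℂ => z + ζ • b) (𝓝 0) (𝓝 z) := by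
      simpa using hline.continuousAt.tendsto
    have hcomp : ContDiffAt ℂ 2 (fun ζ : ℂ => (c : ℂ) + Φ (z + ζ • b)) 0 :=
      contDiffAt_const.add (ContDiffAt.comp (0 : ℂ) (by simpa using hz) hline)
    have hh := (hcomp.harmonicAt).comp_CLM Complex.reCLM
    refine (InnerProductSpace.harmonicAt_congr_nhds ?_).1 hh
    filter_upwards [ht.eventually huz] with ζ hζ
    simp [hζ]

/-- A continuous locally uniform limit of plurisubharmonic functions is plurisubharmonic. -/
theorem IsPlurisubharmonic.of_tendstoLocallyUniformly {v : ℕ → C2 → ℝ} {u : C2 → ℝ}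
    (hv : ∀ n, Continuous (v n)) (hvu : TendstoLocallyUniformly v u atTop)
    (h : ∀ n, ∀ a b : C2, v n a ≤ circleAverage (fun ζ : ℂ => v n (a + ζ • b)) 0 1) :
    IsPlurisubharmonic u := by
  have hu : Continuous u := hvu.continuous (Frequently.of_forall hv)
  have hline : ∀ a b : C2, Continuous fun ζ : ℂ => a + ζ • b := fun a b => by fun_prop
  have hint : ∀ {w : C2 → ℝ}, Continuous w → ∀ a b : C2,
      CircleIntegrable (fun ζ : ℂ => w (a + ζ • b)) 0 1 := fun hw a b =>
    (hw.comp (hline a b)).continuousOn.circleIntegrable'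
  refine ⟨hu.upperSemicontinuous, fun a b => ⟨hint hu a b, ?_⟩⟩
  refine le_of_forall_pos_le_add fun δ hδ => ?_
  have hK : IsCompact ((fun ζ : ℂ => a + ζ • b) '' Metric.closedBall 0 1) :=
    (isCompact_closedBall 0 1).image (hline a b)
  have hunif := (tendstoLocallyUniformlyOn_iff_tendstoUniformlyOn_of_compact hK).1
    hvu.tendstoLocallyUniformlyOn
  obtain ⟨n, hn⟩ := (Metric.tendstoUniformlyOn_iff.1 hunif (δ / 2) (by positivity)).exists
  have hn' : ∀ ζ ∈ Metric.closedBall (0 : ℂ) 1,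
      |u (a + ζ • b) - v n (a + ζ • b)| < δ / 2 := fun ζ hζ => by
    simpa [Real.dist_eq] using hn _ (Set.mem_image_of_mem _ hζ)
  have h0 := abs_lt.1 (hn' 0 (by simp))
  simp only [zero_smul, add_zero] at h0
  have hav : circleAverage (fun ζ : ℂ => v n (a + ζ • b)) 0 1 ≤
      circleAverage (fun ζ : ℂ => u (a + ζ • b) + δ / 2) 0 1 := by
    refine circleAverage_mono (hint (hv n) a b)
      ((hint hu a b).add (circleIntegrable_const _ _ _)) fun ζ hζ => ?_
    have := abs_lt.1 (hn' ζ (Metric.sphere_subset_closedBall (by simpa using hζ)))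
    linarith
  have hadd : circleAverage (fun ζ : ℂ => u (a + ζ • b) + δ / 2) 0 1 =
      circleAverage (fun ζ : ℂ => u (a + ζ • b)) 0 1 + δ / 2 := by
    rw [circleAverage_fun_add (hint hu a b) (circleIntegrable_const _ _ _), circleAverage_const]
  linarith [h n a b]

/-! ### The horn and escaping maps. -/

/-- The largest of `R`, `|x|` and `|y|`. -/
noncomputable def size (R : ℝ) (z : C2) : ℝ := max R (max ‖z 0‖ ‖z 1‖)

/-- The set where the coordinate of index `i` dominates the other one and `R`. -/
def horn (i : Fin 2) (R : ℝ) : Set C2 := {z | ‖z i.rev‖ < ‖z i‖ ∧ R < ‖z i‖}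

theorem size_le_iff {R B : ℝ} {z : C2} (i : Fin 2) :
    size R z ≤ B ↔ R ≤ B ∧ ‖z i.rev‖ ≤ B ∧ ‖z i‖ ≤ B := by
  fin_cases i <;> simp [size, and_comm]

theorem le_size (R : ℝ) (z : C2) : R ≤ size R z := le_max_left _ _

theorem norm_apply_le_size (R : ℝ) (z : C2) (i : Fin 2) : ‖z i‖ ≤ size R z :=
  ((size_le_iff i).1 le_rfl).2.2

theorem size_eq_of_mem_horn {i : Fin 2} {R : ℝ} {z : C2} (hz : z ∈ horn i R) :
    size R z = ‖z i‖ :=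
  le_antisymm ((size_le_iff i).2 ⟨hz.2.le, hz.1.le, le_rfl⟩) (norm_apply_le_size R z i)

theorem continuous_size (R : ℝ) : Continuous (size R) := by
  unfold size
  fun_prop

theorem isOpen_horn (i : Fin 2) (R : ℝ) : IsOpen (horn i R) := by
  have h : ∀ j : Fin 2, Continuous fun z : C2 => ‖z j‖ := fun j => by fun_prop
  exact (isOpen_lt (h i.rev) (h i)).inter (isOpen_lt continuous_const (h i))

theorem size_le_max_norm (R : ℝ) (z : C2) : size R z ≤ max R ‖z‖ :=
  max_le_max le_rfl (max_le (PiLp.norm_apply_le z 0) (PiLp.norm_apply_le z 1))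

theorem norm_le_two_mul_size {R : ℝ} (hR : 1 ≤ R) (z : C2) : ‖z‖ ≤ 2 * size R z := by
  have h0 := norm_apply_le_size R z 0
  have h1 := norm_apply_le_size R z 1
  have hs := hR.trans (le_size R z)
  rw [EuclideanSpace.norm_eq, Fin.sum_univ_two]
  refine Real.sqrt_le_iff.2 ⟨by positivity, ?_⟩
  nlinarith [norm_nonneg (z 0), norm_nonneg (z 1)]

theorem size_pos {R : ℝ} (hR : 1 ≤ R) (z : C2) : 0 < size R z :=
  zero_lt_one.trans_le (hR.trans (le_size R z))

theorem log_size_nonneg {R : ℝ} (hR : 1 ≤ R) (z : C2) : 0 ≤ log (size R z) :=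
  log_nonneg (hR.trans (le_size R z))

theorem posLog_norm_le_log_size {R : ℝ} (hR : 1 ≤ R) (z : C2) :
    log⁺ ‖z‖ ≤ log (size R z) + log 2 := by
  have hs := size_pos hR z
  have h1 := hR.trans (le_size R z)
  calc log⁺ ‖z‖ ≤ log⁺ (2 * size R z) :=
        posLog_le_posLog (norm_nonneg _) (norm_le_two_mul_size hR z)
    _ = log (2 * size R z) := posLog_eq_log (by rw [abs_of_pos (by positivity)]; linarith)
    _ = log (size R z) + log 2 := by rw [log_mul two_ne_zero hs.ne', add_comm]

theorem log_size_le_posLog_norm {R : ℝ} (hR : 1 ≤ R) (z : C2) :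
    log (size R z) ≤ log⁺ ‖z‖ + log R := by
  have hR0 : 0 < R := by linarith
  have hm : 0 < max 1 ‖z‖ := by positivity
  rw [posLog_eq_log_max_one (norm_nonneg _), ← log_mul hm.ne' hR0.ne']
  refine log_le_log (size_pos hR z) ((size_le_max_norm R z).trans (max_le ?_ ?_))
  · nlinarith [le_max_left 1 ‖z‖]
  · nlinarith [le_max_right 1 ‖z‖, le_max_left 1 ‖z‖]

/-- Holomorphic maps of degree `d` that expand the coordinate of index `i` on `horn i R` and do not
increase the size of the points they map outside of the horn, with uniform constants. -/
structure IsEscaping (i : Fin 2) (R C : ℝ) (d : ℕ) (g : C2 → C2) : Prop where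
  contDiff : ContDiff ℂ ∞ g
  mapsTo : ∀ z ∈ horn i R, g z ∈ horn i R
  two_mul_le : ∀ z ∈ horn i R, 2 * ‖z i‖ ≤ ‖g z i‖
  exists_log : ∃ ℓ : C2 → ℂ, ContDiffOn ℂ ∞ ℓ (horn i R) ∧
    ∀ z ∈ horn i R, ‖ℓ z‖ ≤ C ∧ g z i = z i ^ d * Complex.exp (ℓ z)
  size_le : ∀ z, size R (g z) ≤ C * size R z ^ d
  size_le_half : ∀ z, g z ∉ horn i R → size R (g z) ≤ max R (size R z / 2)

namespace IsEscaping

variable {i : Fin 2} {R C : ℝ} {d : ℕ} {g : C2 → C2}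

theorem const_nonneg (hR : 1 ≤ R) (hg : IsEscaping i R C d g) : 0 ≤ C := by
  by_contra! h
  have := (size_pos hR (g 0)).trans_le (hg.size_le 0)
  have := pow_pos (size_pos hR 0) d
  nlinarith

theorem size_le_size (hR : 1 ≤ R) (hg : IsEscaping i R C d g) {z : C2} (hz : g z ∉ horn i R) :
    size R (g z) ≤ size R z :=
  (hg.size_le_half z hz).trans (max_le (le_size R z) (by linarith [size_pos hR z]))

/-- On the horn the exponents combine to `d' ℓ + m ∘ g`. Off it, an image outside the horn forces
the intermediate point outside too, by invariance, so its size did not grow. The constant is the sum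
of the bound `d' C + C'` for the exponent and the bound `C' C ^ d'` for the size. -/
theorem comp {C' : ℝ} {d' : ℕ} {g' : C2 → C2} (hR : 1 ≤ R)
    (hg' : IsEscaping i R C' d' g') (hg : IsEscaping i R C d g) :
    IsEscaping i R (d' * C + C' + C' * C ^ d') (d * d') (g' ∘ g) := by
  have hC := hg.const_nonneg hR
  have hC' := hg'.const_nonneg hR
  obtain ⟨ℓ, hℓ, hℓ'⟩ := hg.exists_log
  obtain ⟨m, hm, hm'⟩ := hg'.exists_log
  refine ⟨hg'.contDiff.comp hg.contDiff, fun z hz => hg'.mapsTo _ (hg.mapsTo z hz), fun z hz => ?_,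
    ⟨fun z => d' * ℓ z + m (g z), ?_, fun z hz => ⟨?_, ?_⟩⟩, fun z => ?_, fun z hz => ?_⟩
  · have := hg.two_mul_le z hz
    have := hg'.two_mul_le _ (hg.mapsTo z hz)
    simp only [Function.comp_apply]
    linarith [norm_nonneg (z i)]
  · exact (contDiffOn_const.mul hℓ).add (hm.comp hg.contDiff.contDiffOn hg.mapsTo)
  · have h1 := (hℓ' z hz).1
    have h2 := (hm' _ (hg.mapsTo z hz)).1
    have h3 : ‖(d' : ℂ) * ℓ z‖ ≤ d' * C := by
      rw [norm_mul, Complex.norm_natCast]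
      gcongr
    have h4 : 0 ≤ C' * C ^ d' := by positivity
    linarith [norm_add_le ((d' : ℂ) * ℓ z) (m (g z))]
  · rw [Function.comp_apply, (hm' _ (hg.mapsTo z hz)).2, (hℓ' z hz).2, mul_pow, ← pow_mul,
      Complex.exp_add, Complex.exp_nat_mul, mul_assoc]
  · have hs := size_pos hR z
    calc size R (g' (g z)) ≤ C' * size R (g z) ^ d' := hg'.size_le _
      _ ≤ C' * (C * size R z ^ d) ^ d' := by
        have := (size_pos hR (g z)).le
        gcongr
        exact hg.size_le z
      _ = C' * C ^ d' * size R z ^ (d * d') := by rw [mul_pow, ← pow_mul, mul_assoc]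
      _ ≤ _ := by
        gcongr
        have : 0 ≤ d' * C := by positivity
        linarith
  · have hz' : g z ∉ horn i R := fun h => hz (hg'.mapsTo _ h)
    refine (hg'.size_le_half _ hz).trans (max_le_max le_rfl ?_)
    linarith [hg.size_le_size hR hz']

theorem log_size_le (hR : 1 ≤ R) (hg : IsEscaping i R C d g) (z : C2) :
    log (size R (g z)) ≤ d * log (size R z) + C := by
  have hs := size_pos hR z
  have h : size R (g z) ≤ size R z ^ d * exp C := (hg.size_le z).trans (by
    rw [mul_comm]
    gcongr
    linarith [add_one_le_exp C])
  have := log_le_log (size_pos hR _) h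
  rwa [log_mul (by positivity) (exp_pos C).ne', log_pow, log_exp] at this

theorem le_log_size (hg : IsEscaping i R C d g) {z : C2} (hR : 1 ≤ R)
    (hz : z ∈ horn i R) : d * log (size R z) - C ≤ log (size R (g z)) := by
  obtain ⟨ℓ, -, hℓ⟩ := hg.exists_log
  have hpos : 0 < ‖z i‖ := by linarith [hz.2]
  rw [size_eq_of_mem_horn hz, size_eq_of_mem_horn (hg.mapsTo z hz), (hℓ z hz).2, norm_mul, norm_pow,
    Complex.norm_exp, log_mul (by positivity) (exp_pos _).ne', log_pow, log_exp]
  linarith [(abs_le.1 ((Complex.abs_re_le_norm (ℓ z)).trans (hℓ z hz).1)).1]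

/-- Cauchy's estimate: the derivative grows with degree `d - 1`. -/
theorem norm_fderiv_mul_size_le (hR : 1 ≤ R) (hg : IsEscaping i R C d g) (z : C2) :
    ‖fderiv ℂ g z‖ * size R z ≤ 4 * 3 ^ d * C * size R z ^ d := by
  have hs := size_pos hR z
  have hC := hg.const_nonneg hR
  -- On a ball of radius `size R z` the size grows by at most a factor 3, so `g` is there bounded by
  -- a multiple of `size R z ^ d`.
  have h := norm_fderiv_le_of_forall_ball_norm_le (f := g) (x := z) (r := size R z)
    (B := 2 * (C * (3 * size R z) ^ d)) hs (hg.contDiff.differentiable (by simp)).differentiableOn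
    fun w hw => by
      have hw' : size R w ≤ 3 * size R z := by
        refine (size_le_iff i).2 ?_
        have h1 : ∀ j, ‖w j‖ ≤ 2 * size R z := fun j => by
          have h2 := (PiLp.norm_apply_le (w - z) j).trans (mem_ball_iff_norm.1 hw).le
          have h3 := norm_apply_le_size R z j
          have h4 := norm_add_le ((w - z) j) (z j)
          simp only [PiLp.sub_apply, sub_add_cancel] at h2 h4
          linarith
        exact ⟨by linarith [le_size R z], by linarith [h1 i.rev], by linarith [h1 i]⟩
      have := size_pos hR w
      refine (norm_le_two_mul_size hR _).trans ?_
      gcongr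
      refine (hg.size_le w).trans ?_
      gcongr
  rw [le_div_iff₀ hs] at h
  refine h.trans_eq ?_
  rw [mul_pow]
  ring

end IsEscaping

/-! ### Orbits: escaping or bounded. -/

/-- The composition `g_{n-1} ∘ ⋯ ∘ g_0`. -/
def orbit (g : ℕ → C2 → C2) : ℕ → C2 → C2
  | 0 => id
  | n + 1 => g n ∘ orbit g n

theorem orbit_succ (g : ℕ → C2 → C2) (n : ℕ) (z : C2) : orbit g (n + 1) z = g n (orbit g n z) := rfl

section Sequence

variable {i : Fin 2} {R C : ℝ} {d : ℕ} {g : ℕ → C2 → C2}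

theorem contDiff_orbit (hg : ∀ n, IsEscaping i R C d (g n)) (n : ℕ) :
    ContDiff ℂ ∞ (orbit g n) := by
  induction n with
  | zero => exact contDiff_id
  | succ n ih => exact (hg n).contDiff.comp ih

/-- As the horn is invariant, all earlier points of the orbit are outside it as well, so the halving
applies at every step. -/
theorem size_orbit_le_of_notMem_horn (hR : 1 ≤ R) (hg : ∀ n, IsEscaping i R C d (g n)) {n : ℕ}
    {z : C2} (hz : orbit g n z ∉ horn i R) : size R (orbit g n z) ≤ max R (size R z / 2 ^ n) := by
  induction n with
  | zero => simp [orbit]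
  | succ n ih =>
    have hz' : orbit g n z ∉ horn i R := fun h => hz ((hg n).mapsTo _ h)
    refine ((hg n).size_le_half _ hz).trans (max_le (le_max_left _ _) ?_)
    have h := ih hz'
    rcases le_max_iff.1 h with h | h
    · exact le_max_of_le_left (by linarith)
    · refine le_max_of_le_right ?_
      rw [pow_succ, ← div_div]
      linarith

theorem size_orbit_le_size (hR : 1 ≤ R) (hg : ∀ n, IsEscaping i R C d (g n)) {n : ℕ}
    {z : C2} (hz : orbit g n z ∉ horn i R) : size R (orbit g n z) ≤ size R z :=
  (size_orbit_le_of_notMem_horn hR hg hz).trans (max_le (le_size R z)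
    (div_le_self (size_pos hR z).le (one_le_pow₀ one_le_two)))

theorem orbit_add_mem_horn (hg : ∀ n, IsEscaping i R C d (g n)) {n : ℕ} {z : C2}
    (hz : orbit g n z ∈ horn i R) (k : ℕ) :
    orbit g (n + k) z ∈ horn i R ∧ 2 ^ k * ‖orbit g n z i‖ ≤ ‖orbit g (n + k) z i‖ := by
  induction k with
  | zero => simpa using hz
  | succ k ih =>
    refine ⟨(hg (n + k)).mapsTo _ ih.1, ?_⟩
    rw [← add_assoc, orbit_succ, pow_succ]
    linarith [(hg (n + k)).two_mul_le _ ih.1]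

theorem tendsto_norm_apply_orbit (hR : 1 ≤ R) (hg : ∀ n, IsEscaping i R C d (g n)) {n : ℕ} {z : C2}
    (hz : orbit g n z ∈ horn i R) : Tendsto (fun n => ‖orbit g n z i‖) atTop atTop := by
  rw [← tendsto_add_atTop_iff_nat n]
  refine tendsto_atTop_mono (fun k => ?_) (tendsto_pow_atTop_atTop_of_one_lt (one_lt_two (α := ℝ)))
  have h := (orbit_add_mem_horn hg hz k).2
  rw [add_comm k n]
  refine le_trans ?_ h
  have : (1 : ℝ) ≤ ‖orbit g n z i‖ := by linarith [hz.2]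
  nlinarith [pow_pos (two_pos (α := ℝ)) k]

/-- Once in the horn, the dominant coordinate doubles at every step; an orbit that never enters
keeps its size below the initial one. -/
theorem tendsto_norm_orbit_iff (hR : 1 ≤ R) (hg : ∀ n, IsEscaping i R C d (g n)) (z : C2) :
    Tendsto (fun n => ‖orbit g n z‖) atTop atTop ↔ ∃ n, orbit g n z ∈ horn i R := by
  constructor
  · intro h
    by_contra! hn
    obtain ⟨n, hn'⟩ := (h.eventually_gt_atTop (2 * size R z)).exists
    have := norm_le_two_mul_size hR (orbit g n z)
    linarith [size_orbit_le_size hR hg (hn n)]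
  · rintro ⟨n, hn⟩
    exact tendsto_atTop_mono (fun n => PiLp.norm_apply_le _ i) (tendsto_norm_apply_orbit hR hg hn)

theorem isBounded_range_orbit_iff (hR : 1 ≤ R) (hg : ∀ n, IsEscaping i R C d (g n)) (z : C2) :
    Bornology.IsBounded (Set.range fun n => orbit g n z) ↔ ∀ n, orbit g n z ∉ horn i R := by
  constructor
  · intro h n hn
    obtain ⟨B, hB⟩ := isBounded_iff_forall_norm_le.1 h
    obtain ⟨k, hk⟩ :=
      (((tendsto_norm_orbit_iff hR hg z).2 ⟨n, hn⟩).eventually_gt_atTop B).exists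
    exact (hB _ (Set.mem_range_self k)).not_gt hk
  · intro h
    refine isBounded_iff_forall_norm_le.2 ⟨2 * size R z, ?_⟩
    rintro _ ⟨n, rfl⟩
    have := norm_le_two_mul_size hR (orbit g n z)
    linarith [size_orbit_le_size hR hg (h n)]

/-! ### The Green function: existence, growth and zero set. -/

/-- `G` is the limit of `d⁻ⁿ log⁺ ‖g_{n-1} ∘ ⋯ ∘ g_0‖`, with an error of order `d⁻ⁿ`. -/
def IsGreen (R C : ℝ) (d : ℕ) (g : ℕ → C2 → C2) (G : C2 → ℝ) : Prop :=
  ∀ n z, |1 / (d : ℝ) ^ n * log⁺ ‖orbit g n z‖ - G z| ≤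
    (2 * (log (size R z) + C) + log (2 * R)) / (d : ℝ) ^ n

/-- The lower bound can fail by more than `C` only off the horn, where the size of the orbit is at
most the initial size. Divided by `d ^ (n + 1)`, this is the geometric step of the Cauchy sequence.
-/
theorem abs_log_size_orbit_succ_sub_le (hR : 1 ≤ R) (hg : ∀ n, IsEscaping i R C d (g n))
    (n : ℕ) (z : C2) : |log (size R (orbit g (n + 1) z)) - d * log (size R (orbit g n z))| ≤
      d * log (size R z) + C := by
  have hC := (hg 0).const_nonneg hR
  have hup := (hg n).log_size_le hR (orbit g n z)
  have h0 : 0 ≤ d * log (size R z) := mul_nonneg (by positivity) (log_size_nonneg hR z)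
  rw [orbit_succ, abs_le]
  refine ⟨?_, by linarith⟩
  by_cases hz : orbit g n z ∈ horn i R
  · linarith [(hg n).le_log_size hR hz]
  · have h1 := log_le_log (size_pos hR _) (size_orbit_le_size hR hg hz)
    have h2 : (d : ℝ) * log (size R (orbit g n z)) ≤ d * log (size R z) := by gcongr
    linarith [log_size_nonneg hR (g n (orbit g n z))]

theorem exists_isGreen (hR : 1 ≤ R) (hd : 2 ≤ d) (hg : ∀ n, IsEscaping i R C d (g n)) :
    ∃ G, IsGreen R C d g G := by
  have hC := (hg 0).const_nonneg hR
  have hd' : (2 : ℝ) ≤ d := by exact_mod_cast hd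
  have hd0 : (0 : ℝ) < d := by linarith
  have hr : 1 / (d : ℝ) < 1 := by rw [div_lt_one hd0]; linarith
  set u : C2 → ℕ → ℝ := fun z n => log (size R (orbit g n z)) / (d : ℝ) ^ n with hu
  have hstep : ∀ z n, dist (u z n) (u z (n + 1)) ≤ (log (size R z) + C) * (1 / (d : ℝ)) ^ n := by
    intro z n
    have h := abs_log_size_orbit_succ_sub_le hR hg n z
    have hpos : (0 : ℝ) < d ^ (n + 1) := by positivity
    have heq : u z n - u z (n + 1) =
        -((log (size R (orbit g (n + 1) z)) - d * log (size R (orbit g n z))) / d ^ (n + 1)) := by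
      simp only [hu, pow_succ]
      field_simp
      ring
    rw [Real.dist_eq, heq, abs_neg, abs_div, abs_of_pos hpos, div_le_iff₀ hpos]
    refine h.trans ?_
    have : (log (size R z) + C) * (1 / (d : ℝ)) ^ n * d ^ (n + 1) = d * (log (size R z) + C) := by
      rw [pow_succ, div_pow, one_pow]
      field_simp
    rw [this]
    nlinarith
  have hex := fun z => cauchySeq_tendsto_of_complete (cauchySeq_of_le_geometric _ _ hr (hstep z))
  choose G hG using hex
  refine ⟨G, fun n z => ?_⟩
  have hpn : (0 : ℝ) < (d : ℝ) ^ n := by positivity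
  have h1 := dist_le_of_le_geometric_of_tendsto _ _ hr (hstep z) (hG z) n
  -- The geometric series costs a factor `1 / (1 - 1 / d) ≤ 2`.
  have h2 : (log (size R z) + C) * (1 / (d : ℝ)) ^ n / (1 - 1 / (d : ℝ)) ≤
      2 * (log (size R z) + C) / (d : ℝ) ^ n := by
    have h3 : (1 : ℝ) / 2 ≤ 1 - 1 / (d : ℝ) := by
      have : 1 / (d : ℝ) ≤ 1 / 2 := by gcongr
      linarith
    have h4 : 0 ≤ (log (size R z) + C) / (d : ℝ) ^ n :=
      div_nonneg (add_nonneg (log_size_nonneg hR z) hC) hpn.le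
    rw [div_pow, one_pow, mul_one_div, div_le_iff₀ (by linarith), mul_div_assoc]
    nlinarith
  have h3 : |1 / (d : ℝ) ^ n * log⁺ ‖orbit g n z‖ - u z n| ≤ log (2 * R) / (d : ℝ) ^ n := by
    have h4 := posLog_norm_le_log_size hR (orbit g n z)
    have h5 := log_size_le_posLog_norm hR (orbit g n z)
    have h6 : log (2 * R) = log 2 + log R := log_mul two_ne_zero (by linarith)
    have h7 : 0 ≤ log R := log_nonneg hR
    have h8 : 0 ≤ log 2 := log_nonneg one_le_two
    simp only [hu]
    rw [one_div_mul_eq_div, ← sub_div, abs_div, abs_of_pos hpn]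
    gcongr
    rw [abs_le]
    constructor <;> linarith
  rw [Real.dist_eq] at h1
  rw [add_div]
  refine (abs_sub_le _ (u z n) _).trans ?_
  linarith

namespace IsGreen

variable {G : C2 → ℝ}

theorem tendsto (hd : 2 ≤ d) (hG : IsGreen R C d g G) (z : C2) :
    Tendsto (fun n => 1 / (d : ℝ) ^ n * log⁺ ‖orbit g n z‖) atTop (𝓝 (G z)) := by
  have hd' : (1 : ℝ) < d := by exact_mod_cast hd
  rw [tendsto_iff_dist_tendsto_zero]
  refine squeeze_zero (fun _ => dist_nonneg) (fun n => hG n z) ?_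
  exact tendsto_const_nhds.div_atTop (tendsto_pow_atTop_atTop_of_one_lt hd')

theorem nonneg (hd : 2 ≤ d) (hG : IsGreen R C d g G) (z : C2) : 0 ≤ G z :=
  ge_of_tendsto' (hG.tendsto hd z) fun _ => mul_nonneg (by positivity) posLog_nonneg

theorem le_posLog_add (hR : 1 ≤ R) (hd : 2 ≤ d) (hg : ∀ n, IsEscaping i R C d (g n))
    (hG : IsGreen R C d g G) (z : C2) : G z ≤ log⁺ ‖z‖ + (log R + C + log 2) := by
  have hC := (hg 0).const_nonneg hR
  have hd' : (2 : ℝ) ≤ d := by exact_mod_cast hd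
  -- The summand `- C` lets the induction absorb the error `C` of each step, because `d ≥ 2`.
  have h : ∀ n, log (size R (orbit g n z)) ≤ d ^ n * (log (size R z) + C) - C := by
    intro n
    induction n with
    | zero => simp [orbit]
    | succ n ih =>
      have h1 := (hg n).log_size_le hR (orbit g n z)
      rw [orbit_succ, pow_succ]
      nlinarith
  refine le_of_tendsto' (hG.tendsto hd z) fun n => ?_
  have h1 := log_size_le_posLog_norm hR z
  have h2 := posLog_norm_le_log_size hR (orbit g n z)
  have h3 : (1 : ℝ) ≤ d ^ n := one_le_pow₀ (by linarith)
  have h4 : 0 ≤ log 2 := log_nonneg one_le_two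
  rw [one_div_mul_eq_div, div_le_iff₀ (by positivity)]
  nlinarith [h n]

theorem le_of_mem_horn (hR : 1 ≤ R) (hd : 2 ≤ d) (hg : ∀ n, IsEscaping i R C d (g n))
    (hG : IsGreen R C d g G) {z : C2} {n : ℕ} (hz : orbit g n z ∈ horn i R) :
    (log ‖orbit g n z i‖ - C) / (d : ℝ) ^ n ≤ G z := by
  have hC := (hg 0).const_nonneg hR
  have hd' : (2 : ℝ) ≤ d := by exact_mod_cast hd
  have h : ∀ k, d ^ k * (log ‖orbit g n z i‖ - C) + C ≤ log (size R (orbit g (n + k) z)) := by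
    intro k
    induction k with
    | zero => simp [size_eq_of_mem_horn hz]
    | succ k ih =>
      have h1 := (hg (n + k)).le_log_size hR (orbit_add_mem_horn hg hz k).1
      rw [← add_assoc, orbit_succ, pow_succ]
      nlinarith
  have ht := (hG.tendsto hd z).comp (tendsto_add_atTop_nat n)
  refine ge_of_tendsto' ht fun k => ?_
  simp only [Function.comp_apply]
  have hmem := (orbit_add_mem_horn hg hz k).1
  have h2 := h k
  rw [size_eq_of_mem_horn hmem] at h2
  have h3 : log ‖orbit g (n + k) z i‖ ≤ log⁺ ‖orbit g (n + k) z‖ :=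
    (le_max_right _ _).trans (posLog_le_posLog (norm_nonneg _) (PiLp.norm_apply_le _ i))
  rw [add_comm k n, one_div_mul_eq_div, pow_add, div_le_div_iff₀ (by positivity) (by positivity)]
  have hpn : (0 : ℝ) < d ^ n := by positivity
  nlinarith

theorem pos_of_mem_horn (hR : 1 ≤ R) (hd : 2 ≤ d) (hg : ∀ n, IsEscaping i R C d (g n))
    (hG : IsGreen R C d g G) {z : C2} {n : ℕ} (hz : orbit g n z ∈ horn i R) : 0 < G z := by
  -- The lower bound `le_of_mem_horn` is useful only once `log` of the dominant coordinate exceeds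
  -- `C`, which happens later in the orbit.
  have ht := (tendsto_log_atTop.comp (tendsto_norm_apply_orbit hR hg hz)).comp
    (tendsto_add_atTop_nat n)
  obtain ⟨k, hk⟩ := (ht.eventually_gt_atTop C).exists
  simp only [Function.comp_apply, add_comm k n] at hk
  have hd' : (2 : ℝ) ≤ d := by exact_mod_cast hd
  refine lt_of_lt_of_le ?_ (hG.le_of_mem_horn hR hd hg (orbit_add_mem_horn hg hz k).1)
  have : (0 : ℝ) < d ^ (n + k) := by positivity
  exact div_pos (sub_pos.2 hk) this

theorem eq_zero_of_notMem_horn (hR : 1 ≤ R) (hd : 2 ≤ d) (hg : ∀ n, IsEscaping i R C d (g n))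
    (hG : IsGreen R C d g G) {z : C2} (hz : ∀ n, orbit g n z ∉ horn i R) : G z = 0 := by
  refine tendsto_nhds_unique (hG.tendsto hd z) ?_
  have hd' : (1 : ℝ) < d := by exact_mod_cast hd
  refine squeeze_zero (g := fun n => (log (size R z) + log 2) / (d : ℝ) ^ n)
    (fun n => mul_nonneg (by positivity) posLog_nonneg) (fun n => ?_)
    (tendsto_const_nhds.div_atTop (tendsto_pow_atTop_atTop_of_one_lt hd'))
  rw [one_div_mul_eq_div]
  gcongr
  have h1 := log_le_log (size_pos hR _) (size_orbit_le_size hR hg (hz n))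
  linarith [posLog_norm_le_log_size hR (orbit g n z)]

end IsGreen

end Sequence

/-- The space `Y` is `C2` for a fixed parameter sequence, and the product of the sequence space with
`C2` for joint continuity. -/
theorem tendstoLocallyUniformly_of_size_le {Y : Type*} [TopologicalSpace Y] {R C : ℝ} {d : ℕ}
    (hR : 1 ≤ R) (hd : 2 ≤ d) {f : ℕ → Y → ℝ} {G : Y → ℝ} {s : Y → C2} (hs : Continuous s)
    (h : ∀ n y, |f n y - G y| ≤
      (2 * (log (size R (s y)) + C) + log (2 * R)) / (d : ℝ) ^ n) :
    TendstoLocallyUniformly f G atTop := by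
  have hd' : (1 : ℝ) < d := by exact_mod_cast hd
  rw [Metric.tendstoLocallyUniformly_iff]
  intro ε hε y
  set A : ℝ := 2 * (log (size R (s y) + 1) + C) + log (2 * R)
  refine ⟨{w | size R (s w) < size R (s y) + 1},
    ((continuous_size R).comp hs).continuousAt.eventually_lt_const (by simp), ?_⟩
  have ht : Tendsto (fun n => A / (d : ℝ) ^ n) atTop (𝓝 0) :=
    tendsto_const_nhds.div_atTop (tendsto_pow_atTop_atTop_of_one_lt hd')
  filter_upwards [ht.eventually_lt_const hε] with n hn w hw
  rw [dist_comm, Real.dist_eq]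
  refine (h n w).trans_lt (lt_of_le_of_lt ?_ hn)
  have := log_le_log (size_pos hR (s w)) (le_of_lt hw)
  simp only [A]
  gcongr

/-! ### Hölder continuity. -/

/-- If the factors are eventually at most `B`, then the products grow at most like `B ^ n`. -/
theorem exists_prod_range_le_mul_pow {b : ℕ → ℝ} {B : ℝ} (hb : ∀ n, 0 ≤ b n) (hB : 0 < B)
    (h : ∀ᶠ n in atTop, b n ≤ B) : ∃ Q, 0 ≤ Q ∧ ∀ n, ∏ j ∈ Finset.range n, b j ≤ Q * B ^ n := by
  obtain ⟨N, hN⟩ := eventually_atTop.1 h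
  have hnn : ∀ n, 0 ≤ (∏ j ∈ Finset.range n, b j) / B ^ n := fun n =>
    div_nonneg (Finset.prod_nonneg fun j _ => hb j) (by positivity)
  refine ⟨∑ n ∈ Finset.range (N + 1), (∏ j ∈ Finset.range n, b j) / B ^ n,
    Finset.sum_nonneg fun n _ => hnn n, fun n => ?_⟩
  have hle : ∀ n ≤ N, (∏ j ∈ Finset.range n, b j) / B ^ n ≤
      ∑ n ∈ Finset.range (N + 1), (∏ j ∈ Finset.range n, b j) / B ^ n := fun n hn =>
    Finset.single_le_sum (f := fun n => (∏ j ∈ Finset.range n, b j) / B ^ n)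
      (fun n _ => hnn n) (Finset.mem_range.2 (by lia))
  rw [← div_le_iff₀ (by positivity)]
  rcases le_total n N with hn | hn
  · exact hle n hn
  · induction n, hn using Nat.le_induction with
    | base => exact hle N le_rfl
    | succ n hn ih =>
      refine le_trans ?_ ih
      rw [Finset.prod_range_succ, pow_succ, mul_div_mul_comm]
      exact mul_le_of_le_one_right (hnn n) ((div_le_one hB).2 (hN n hn))

/-- A smooth substitute for `log⁺`, to which the mean value inequality applies. -/
theorem abs_half_log_one_add_sq_sub_posLog_le {t : ℝ} (ht : 0 ≤ t) :
    |log (1 + t ^ 2) / 2 - log⁺ t| ≤ log 2 := by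
  have hm : 1 ≤ max 1 t := le_max_left _ _
  have hm0 : 0 < max 1 t := by linarith
  have h2 : 0 ≤ log 2 := log_nonneg one_le_two
  have hsq : log (max 1 t ^ 2) = 2 * log (max 1 t) := by rw [log_pow]; norm_num
  rw [posLog_eq_log_max_one ht]
  have h3 : log (max 1 t ^ 2) ≤ log (1 + t ^ 2) := by
    refine log_le_log (by positivity) ?_
    rcases max_cases 1 t with ⟨h, -⟩ | ⟨h, -⟩ <;> rw [h] <;> nlinarith
  have h4 : log (1 + t ^ 2) ≤ log (2 * max 1 t ^ 2) := by
    refine log_le_log (by positivity) ?_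
    nlinarith [le_max_right 1 t]
  rw [log_mul two_ne_zero (by positivity)] at h4
  rw [abs_le]
  constructor <;> linarith

/-- A map whose derivative is controlled by its norm has a Lipschitz logarithm. -/
theorem abs_log_one_add_norm_sq_sub_le {E F : Type*} [NormedAddCommGroup E] [NormedSpace ℝ E]
    [NormedAddCommGroup F] [InnerProductSpace ℝ F] {f : E → F} {f' : E → E →L[ℝ] F} {s : Set E}
    {B : ℝ} (hs : Convex ℝ s) (hf : ∀ x ∈ s, HasFDerivAt f (f' x) x)
    (hB : ∀ x ∈ s, ‖f x‖ * ‖f' x‖ ≤ B * (1 + ‖f x‖ ^ 2)) {x y : E} (hx : x ∈ s) (hy : y ∈ s) :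
    |log (1 + ‖f x‖ ^ 2) / 2 - log (1 + ‖f y‖ ^ 2) / 2| ≤ B * ‖x - y‖ := by
  have hder : ∀ z ∈ s, HasFDerivAt (fun z => log (1 + ‖f z‖ ^ 2) / 2)
      ((1 + ‖f z‖ ^ 2)⁻¹ • (innerSL ℝ (f z)).comp (f' z)) z := by
    intro z hz
    have h1 := (((hf z hz).norm_sq.const_add 1).log (by positivity)).mul_const (2⁻¹ : ℝ)
    simp only [div_eq_mul_inv]
    refine h1.congr_fderiv ?_
    ext v
    simp
    ring
  refine hs.norm_image_sub_le_of_norm_hasFDerivWithin_le (f := fun z => log (1 + ‖f z‖ ^ 2) / 2)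
    (fun z hz => (hder z hz).hasFDerivWithinAt) (fun z hz => ?_) hy hx
  have h0 : 0 < 1 + ‖f z‖ ^ 2 := by positivity
  rw [norm_smul, norm_inv, Real.norm_of_nonneg h0.le, inv_mul_le_iff₀ h0, mul_comm _ B]
  refine le_trans (ContinuousLinearMap.opNorm_comp_le _ _) ?_
  rw [innerSL_apply_norm]
  exact hB z hz

/-- Interpolation between approximations whose Lipschitz constants grow and whose errors decay
geometrically. -/
theorem exists_holderOnWith_of_forall_nat {E : Type*} [NormedAddCommGroup E] {u : E → ℝ}
    {S : Set E} {A B D d : ℝ} (hd : 1 < d) (hdB : d ≤ B) (hA : 0 ≤ A)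
    (hS : ∀ x ∈ S, ∀ y ∈ S, ‖x - y‖ ≤ D)
    (h : ∀ n : ℕ, ∀ x ∈ S, ∀ y ∈ S, |u x - u y| ≤ A * (1 + B ^ n * ‖x - y‖) / d ^ n)
    {β : NNReal} (hβ0 : 0 < β) (hβ : (β : ℝ) = log d / log B) :
    ∃ C : NNReal, HolderOnWith C β u S := by
  have hB : 1 < B := hd.trans_le hdB
  have hB0 : 0 < B := by linarith
  have hβ0' : (0 : ℝ) < β := hβ0
  have hBβ : B ^ (β : ℝ) = d := by
    rw [hβ, rpow_def_of_pos hB0, mul_div_cancel₀ _ (log_pos hB).ne', exp_log (by linarith)]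
  have key : ∀ x ∈ S, ∀ y ∈ S, |u x - u y| ≤ (2 * A * d + A * (1 + |D|)) * ‖x - y‖ ^ (β : ℝ) := by
    intro x hx y hy
    rcases eq_or_ne x y with rfl | hxy
    · simp [hβ0'.ne']
    have hδ : 0 < ‖x - y‖ := norm_pos_iff.2 (sub_ne_zero.2 hxy)
    set δ := ‖x - y‖ with hδ'
    have hδβ : 0 < δ ^ (β : ℝ) := rpow_pos_of_pos hδ _
    have h2A : 0 ≤ 2 * A * d := by positivity
    have hAD : 0 ≤ A * (1 + |D|) := by positivity
    rcases le_or_gt δ 1 with h1 | h1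
    -- With `B ^ n ≤ δ⁻¹ < B ^ (n + 1)` the Lipschitz term is at most 1, and `d = B ^ β` turns `1 /
    -- d ^ n` into at most `d * δ ^ β`.
    · obtain ⟨n, hn, hn'⟩ := exists_nat_pow_near ((one_le_inv₀ hδ).2 h1) hB
      have h2 : B ^ n * δ ≤ 1 := by
        calc B ^ n * δ ≤ δ⁻¹ * δ := by gcongr
          _ = 1 := inv_mul_cancel₀ hδ.ne'
      have h3 : 1 ≤ d ^ (n + 1) * δ ^ (β : ℝ) := by
        rw [← hBβ, ← rpow_natCast, ← rpow_mul hB0.le, mul_comm (β : ℝ), rpow_mul hB0.le,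
          rpow_natCast, ← mul_rpow (by positivity) hδ.le]
        refine one_le_rpow ?_ hβ0'.le
        calc 1 = δ⁻¹ * δ := (inv_mul_cancel₀ hδ.ne').symm
          _ ≤ B ^ (n + 1) * δ := by gcongr
      have hdn : 0 < d ^ n := by positivity
      have h4 : A * (1 + B ^ n * δ) / d ^ n ≤ 2 * A * d * δ ^ (β : ℝ) := by
        rw [div_le_iff₀ hdn]
        rw [pow_succ] at h3
        nlinarith
      nlinarith [h n x hx y hy]
    · have h2 : 1 ≤ δ ^ (β : ℝ) := one_le_rpow h1.le hβ0'.le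
      have h3 := h 0 x hx y hy
      simp only [pow_zero, one_mul, div_one] at h3
      have h4 : A * (1 + δ) ≤ A * (1 + |D|) := by
        gcongr
        exact (hS x hx y hy).trans (le_abs_self D)
      nlinarith
  have hc : 0 ≤ 2 * A * d + A * (1 + |D|) := by positivity
  refine ⟨(2 * A * d + A * (1 + |D|)).toNNReal, fun x hx y hy => ?_⟩
  have h1 := key x hx y hy
  rw [edist_nndist, edist_nndist, ← ENNReal.coe_rpow_of_nonneg _ hβ0'.le, ← ENNReal.coe_mul,
    ENNReal.coe_le_coe, ← NNReal.coe_le_coe]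
  rw [NNReal.coe_mul, Real.coe_toNNReal _ hc, NNReal.coe_rpow, coe_nndist, coe_nndist,
    Real.dist_eq, dist_eq_norm]
  exact h1

section Sequence

variable {i : Fin 2} {R C : ℝ} {d : ℕ} {g : ℕ → C2 → C2}

/-- Keeping the factor `size R (orbit g n z)` makes this a bound for the logarithmic derivative. The
other factors settle at a constant independent of `ρ`, since `ρ / 2 ^ j` eventually drops below `R`.
-/
theorem norm_fderiv_orbit_le (hR : 1 ≤ R) (hg : ∀ n, IsEscaping i R C d (g n)) {ρ : ℝ} {z : C2}
    (hz : size R z ≤ ρ) (n : ℕ) : ‖fderiv ℂ (orbit g n) z‖ ≤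
      (∏ j ∈ Finset.range n, 4 * 3 ^ d * C * exp C * max R (ρ / 2 ^ j) ^ d) *
        size R (orbit g n z) := by
  have hC := (hg 0).const_nonneg hR
  have hnn : ∀ j, 0 ≤ 4 * 3 ^ d * C * exp C * max R (ρ / 2 ^ j) ^ d := fun j => by
    have : 0 ≤ max R (ρ / 2 ^ j) := le_max_of_le_left (by linarith)
    positivity
  induction n with
  | zero =>
    have h1 : fderiv ℂ (orbit g 0) z = ContinuousLinearMap.id ℂ C2 := fderiv_id
    rw [h1]
    simp only [orbit, Finset.range_zero, Finset.prod_empty, one_mul, id]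
    exact ContinuousLinearMap.norm_id_le.trans (hR.trans (le_size R z))
  | succ n ih =>
    set P := ∏ j ∈ Finset.range n, 4 * 3 ^ d * C * exp C * max R (ρ / 2 ^ j) ^ d
    have hP : 0 ≤ P := Finset.prod_nonneg fun j _ => hnn j
    set w := orbit g n z with hw
    have hs := size_pos hR w
    have hs' := size_pos hR (g n w)
    have h1 : fderiv ℂ (orbit g (n + 1)) z = (fderiv ℂ (g n) w).comp (fderiv ℂ (orbit g n) z) :=
      fderiv_comp z ((hg n).contDiff.differentiable (by simp) w)
        ((contDiff_orbit hg n).differentiable (by simp) z)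
    -- On the horn, `g n` really grows with degree `d`; off it, `w` itself has size at most `max R
    -- (ρ / 2 ^ n)`.
    have h2 : size R w ^ d ≤ exp C * max R (ρ / 2 ^ n) ^ d * size R (g n w) := by
      have hm : 1 ≤ max R (ρ / 2 ^ n) ^ d := one_le_pow₀ (le_max_of_le_left hR)
      have he : 1 ≤ exp C := one_le_exp hC
      by_cases hwh : w ∈ horn i R
      · have h3 := (hg n).le_log_size hR hwh
        rw [sub_le_iff_le_add] at h3
        have h4 := exp_le_exp.2 h3
        rw [exp_add, exp_log hs', exp_nat_mul, exp_log hs] at h4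
        calc size R w ^ d ≤ size R (g n w) * exp C * 1 := by linarith
          _ ≤ size R (g n w) * exp C * max R (ρ / 2 ^ n) ^ d := by gcongr
          _ = _ := by ring
      · have h3 : size R w ≤ max R (ρ / 2 ^ n) :=
          (size_orbit_le_of_notMem_horn hR hg hwh).trans (max_le_max le_rfl (by gcongr))
        calc size R w ^ d ≤ 1 * max R (ρ / 2 ^ n) ^ d * 1 := by
              rw [one_mul, mul_one]
              gcongr
          _ ≤ exp C * max R (ρ / 2 ^ n) ^ d * size R (g n w) := by
              gcongr
              exact hR.trans (le_size R _)
    rw [h1, Finset.prod_range_succ, orbit_succ, ← hw]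
    calc _ ≤ ‖fderiv ℂ (g n) w‖ * ‖fderiv ℂ (orbit g n) z‖ := ContinuousLinearMap.opNorm_comp_le _ _
      _ ≤ ‖fderiv ℂ (g n) w‖ * (P * size R w) := by gcongr
      _ = P * (‖fderiv ℂ (g n) w‖ * size R w) := by ring
      _ ≤ P * (4 * 3 ^ d * C * size R w ^ d) :=
        mul_le_mul_of_nonneg_left ((hg n).norm_fderiv_mul_size_le hR w) hP
      _ ≤ P * (4 * 3 ^ d * C * (exp C * max R (ρ / 2 ^ n) ^ d * size R (g n w))) := by gcongr
      _ = _ := by ring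

namespace IsGreen

variable {G : C2 → ℝ}

theorem isLocallyHolder (hR : 1 ≤ R) (hd : 2 ≤ d) (hg : ∀ n, IsEscaping i R C d (g n))
    (hG : IsGreen R C d g G) : IsLocallyHolder G := by
  have hC := (hg 0).const_nonneg hR
  have hd' : (2 : ℝ) ≤ d := by exact_mod_cast hd
  -- The limit of the factors in `norm_fderiv_orbit_le`; adding `d` ensures `d ≤ B`, so that the
  -- exponent is at most 1.
  set B : ℝ := 4 * 3 ^ d * C * exp C * R ^ d + d with hB
  have hdB : (d : ℝ) ≤ B := by
    have : 0 ≤ 4 * 3 ^ d * C * exp C * R ^ d := by positivity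
    linarith
  have hB0 : 0 < B := by linarith
  have hlogd : 0 < log (d : ℝ) := log_pos (by linarith)
  have hlogB : 0 < log B := log_pos (by linarith)
  refine ⟨⟨log d / log B, by positivity⟩, div_pos hlogd hlogB, ?_, fun K hK => ?_⟩
  · exact (div_le_one hlogB).2 (log_le_log (by linarith) hdB)
  obtain ⟨r, hr⟩ := hK.isBounded.subset_closedBall (0 : C2)
  set ρ := max R r with hρ
  have hsize : ∀ z ∈ Metric.closedBall (0 : C2) r, size R z ≤ ρ := fun z hz =>
    (size_le_max_norm R z).trans (max_le_max le_rfl (mem_closedBall_zero_iff.1 hz))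
  have hρ1 : 1 ≤ ρ := le_max_of_le_left hR
  have hlim : Tendsto (fun n : ℕ => ρ / 2 ^ n) atTop (𝓝 0) :=
    tendsto_const_nhds.div_atTop (tendsto_pow_atTop_atTop_of_one_lt one_lt_two)
  obtain ⟨Q, hQ0, hQ⟩ := exists_prod_range_le_mul_pow
    (b := fun j => 4 * 3 ^ d * C * exp C * max R (ρ / 2 ^ j) ^ d) (B := B) (fun j => by
      have : 0 ≤ max R (ρ / 2 ^ j) := le_max_of_le_left (by linarith)
      positivity) hB0 (by
      filter_upwards [hlim.eventually_lt_const (u := R) (by linarith)] with n hn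
      rw [max_eq_left hn.le]
      linarith)
  set A₀ : ℝ := 2 * (log ρ + C) + log (2 * R) + log 2 with hA₀
  have hA₀0 : 0 ≤ A₀ := by
    have h1 := log_nonneg hρ1
    have h2 : 0 ≤ log (2 * R) := log_nonneg (by linarith)
    have h3 : 0 ≤ log 2 := log_nonneg one_le_two
    positivity
  have hlip : ∀ n, ∀ z ∈ Metric.closedBall (0 : C2) r, ∀ w ∈ Metric.closedBall (0 : C2) r,
      |log (1 + ‖orbit g n z‖ ^ 2) / 2 - log (1 + ‖orbit g n w‖ ^ 2) / 2| ≤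
        Q * B ^ n * R * ‖z - w‖ := by
    intro n z hz w hw
    refine abs_log_one_add_norm_sq_sub_le (convex_closedBall (0 : C2) r)
      (f' := fun z => (fderiv ℂ (orbit g n) z).restrictScalars ℝ)
      (fun x _ => (((contDiff_orbit hg n).differentiable (by simp) x).hasFDerivAt).restrictScalars
        ℝ) (fun x hx => ?_) hz hw
    rw [ContinuousLinearMap.norm_restrictScalars]
    have h1 := (norm_fderiv_orbit_le hR hg (hsize x hx) n).trans
      (mul_le_mul_of_nonneg_right (hQ n) (size_pos hR _).le)
    set t := ‖orbit g n x‖ with ht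
    have ht0 : 0 ≤ t := norm_nonneg _
    have h2 : t * size R (orbit g n x) ≤ R * (1 + t ^ 2) := by
      rcases le_max_iff.1 (size_le_max_norm R (orbit g n x)) with h | h
      · nlinarith [mul_le_mul_of_nonneg_left h ht0, sq_nonneg (t - 1)]
      · nlinarith [mul_le_mul_of_nonneg_left h ht0, sq_nonneg t]
    calc t * ‖fderiv ℂ (orbit g n) x‖ ≤ t * (Q * B ^ n * size R (orbit g n x)) := by gcongr
      _ = Q * B ^ n * (t * size R (orbit g n x)) := by ring
      _ ≤ Q * B ^ n * (R * (1 + t ^ 2)) := by gcongr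
      _ = _ := by ring
  have happ : ∀ n, ∀ z ∈ Metric.closedBall (0 : C2) r,
      |log (1 + ‖orbit g n z‖ ^ 2) / 2 - (d : ℝ) ^ n * G z| ≤ A₀ := by
    intro n z hz
    have h1 := hG n z
    have h2 := abs_half_log_one_add_sq_sub_posLog_le (norm_nonneg (orbit g n z))
    have hpn : (0 : ℝ) < (d : ℝ) ^ n := by positivity
    have h3 : log⁺ ‖orbit g n z‖ - (d : ℝ) ^ n * G z =
        (1 / (d : ℝ) ^ n * log⁺ ‖orbit g n z‖ - G z) * (d : ℝ) ^ n := by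
      field_simp
    have h4 : |log⁺ ‖orbit g n z‖ - (d : ℝ) ^ n * G z| ≤
        2 * (log (size R z) + C) + log (2 * R) := by
      rw [h3, abs_mul, abs_of_pos hpn]
      exact (le_div_iff₀ hpn).1 h1
    have h5 := log_le_log (size_pos hR z) (hsize z hz)
    have h6 := abs_sub_le (log (1 + ‖orbit g n z‖ ^ 2) / 2) (log⁺ ‖orbit g n z‖)
      ((d : ℝ) ^ n * G z)
    linarith
  have hA0 : 0 ≤ 2 * A₀ + Q * R := by positivity
  refine exists_holderOnWith_of_forall_nat (A := 2 * A₀ + Q * R) (B := B) (D := 2 * r)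
    (d := d) (by linarith) hdB hA0 ?_ ?_ (div_pos hlogd hlogB) rfl
  · intro x hx y hy
    have h1 := mem_closedBall_zero_iff.1 (hr hx)
    have h2 := mem_closedBall_zero_iff.1 (hr hy)
    linarith [norm_sub_le x y]
  · intro n x hx y hy
    have hpn : (0 : ℝ) < (d : ℝ) ^ n := by positivity
    have h1 := abs_le.1 (happ n x (hr hx))
    have h2 := abs_le.1 (happ n y (hr hy))
    have h3 := abs_le.1 (hlip n x (hr hx) y (hr hy))
    rw [le_div_iff₀ hpn, ← abs_of_pos (a := (d : ℝ) ^ n) hpn, ← abs_mul]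
    have h4 : 0 ≤ A₀ * (B ^ n * ‖x - y‖) := by positivity
    have h5 : 0 ≤ Q * R := by positivity
    rw [abs_le]
    constructor <;> nlinarith

/-! ### Pluriharmonicity on the escaping set. -/

theorem tendsto_log_size (hR : 1 ≤ R) (hd : 2 ≤ d) (hG : IsGreen R C d g G) (z : C2) :
    Tendsto (fun n => log (size R (orbit g n z)) / (d : ℝ) ^ n) atTop (𝓝 (G z)) := by
  have hd' : (1 : ℝ) < d := by exact_mod_cast hd
  have hpow := tendsto_pow_atTop_atTop_of_one_lt hd'
  have hlim : ∀ c : ℝ, Tendsto (fun n : ℕ =>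
      1 / (d : ℝ) ^ n * log⁺ ‖orbit g n z‖ + c / (d : ℝ) ^ n) atTop (𝓝 (G z)) := fun c => by
    simpa using (hG.tendsto hd z).add (tendsto_const_nhds (x := c) |>.div_atTop hpow)
  refine tendsto_of_tendsto_of_tendsto_of_le_of_le (hlim (-log 2)) (hlim (log R))
    (fun n => ?_) fun n => ?_
  · simp only []
    rw [one_div_mul_eq_div, ← add_div]
    gcongr
    linarith [posLog_norm_le_log_size hR (orbit g n z)]
  · simp only []
    rw [one_div_mul_eq_div, ← add_div]
    gcongr
    exact log_size_le_posLog_norm hR (orbit g n z)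

/-- On the set of points whose orbit enters the horn, a Green function is locally the real part of
a holomorphic function, up to an additive constant. -/
theorem exists_eventuallyEq_re (hR : 1 ≤ R) (hd : 2 ≤ d) (hg : ∀ n, IsEscaping i R C d (g n))
    (hG : IsGreen R C d g G) {a : C2} {n : ℕ} (ha : orbit g n a ∈ horn i R) :
    ∃ (Φ : C2 → ℂ) (c : ℝ), ContDiffAt ℂ 2 Φ a ∧ G =ᶠ[𝓝 a] fun z => c + (Φ z).re := by
  have hC := (hg 0).const_nonneg hR
  have hd' : (2 : ℝ) ≤ d := by exact_mod_cast hd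
  have hd0 : (0 : ℝ) < d := by linarith
  choose ℓ hℓ hℓ' using fun k => (hg k).exists_log
  set U : Set C2 := orbit g n ⁻¹' horn i R with hU
  have hUo : IsOpen U := (isOpen_horn i R).preimage (contDiff_orbit hg n).continuous
  have hmem : ∀ k, ∀ z ∈ U, orbit g (n + k) z ∈ horn i R := fun k z hz =>
    (orbit_add_mem_horn hg hz k).1
  -- Taking `log` of `y_{k+1} = y_k ^ d * exp ℓ_k` and dividing by `d ^ (k + 1)` adds the real part
  -- of this term.
  set f : ℕ → C2 → ℂ := fun k z => ℓ (n + k) (orbit g (n + k) z) / (d : ℂ) ^ (k + 1) with hf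
  have hfs : ∀ k, ContDiffOn ℂ ∞ (f k) U := fun k =>
    ((hℓ (n + k)).comp (contDiff_orbit hg (n + k)).contDiffOn (hmem k)).div_const _
  have hfb : ∀ k, ∀ z ∈ U, ‖f k z‖ ≤ C * (1 / 2) ^ k := by
    intro k z hz
    have h1 : (2 : ℝ) ^ k ≤ (d : ℝ) ^ (k + 1) := by
      calc (2 : ℝ) ^ k ≤ 2 ^ (k + 1) := pow_le_pow_right₀ one_le_two (Nat.le_succ k)
        _ ≤ (d : ℝ) ^ (k + 1) := by gcongr
    simp only [hf]
    rw [norm_div, norm_pow, Complex.norm_natCast, div_pow, one_pow, mul_one_div]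
    gcongr
    exact ((hℓ' (n + k)) _ (hmem k z hz)).1
  have hsum : Summable fun k : ℕ => C * (1 / 2 : ℝ) ^ k := summable_geometric_two.mul_left C
  set φ : ℕ → C2 → ℂ := fun N z => ∑ k ∈ Finset.range N, f k z with hφ
  set Φ : C2 → ℂ := fun z => ∑' k, f k z with hΦ
  have hunif : TendstoUniformlyOn φ Φ atTop U :=
    tendstoUniformlyOn_tsum_nat hsum fun k z hz => hfb k z hz
  have hlog : ∀ z ∈ U, ∀ k, log (size R (orbit g (n + k) z)) / (d : ℝ) ^ (n + k) =
      (log ‖orbit g n z i‖ + (φ k z).re) / (d : ℝ) ^ n := by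
    intro z hz k
    induction k with
    | zero => simp [hφ, size_eq_of_mem_horn (show orbit g n z ∈ horn i R from hz)]
    | succ k ih =>
      have hm := hmem k z hz
      have hpos : 0 < ‖orbit g (n + k) z i‖ := by linarith [hm.2]
      have hre : (f k z).re = (ℓ (n + k) (orbit g (n + k) z)).re / (d : ℝ) ^ (k + 1) := by
        simp only [hf]
        rw [← Complex.ofReal_natCast, ← Complex.ofReal_pow, Complex.div_ofReal_re]
      have hφs : (φ (k + 1) z).re = (φ k z).re + (f k z).re := by
        simp only [hφ, Finset.sum_range_succ, Complex.add_re]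
      rw [← add_assoc, orbit_succ, size_eq_of_mem_horn ((hg (n + k)).mapsTo _ hm), ((hℓ' (n + k)) _ hm).2, norm_mul, norm_pow, Complex.norm_exp,
        log_mul (by positivity) (exp_pos _).ne', log_pow, log_exp, hφs, hre]
      rw [size_eq_of_mem_horn hm, div_eq_div_iff (by positivity) (by positivity), pow_add] at ih
      rw [div_eq_div_iff (by positivity) (by positivity)]
      field_simp
      field_simp at ih
      have h2 : (d : ℝ) ^ (n + k + 1) = d ^ n * (d ^ k * d) := by ring
      have h3 : (d : ℝ) ^ (k + 1) = d ^ k * d := by ring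
      simp only [h2, h3]
      rw [ih]
      ring
  have hGU : ∀ z ∈ U, G z = (log ‖orbit g n z i‖ + (Φ z).re) / (d : ℝ) ^ n := by
    intro z hz
    have h1 : Tendsto (fun k => log (size R (orbit g (n + k) z)) / (d : ℝ) ^ (n + k)) atTop
        (𝓝 (G z)) := by
      have := (hG.tendsto_log_size hR hd z).comp (tendsto_add_atTop_nat n)
      simpa only [Function.comp_def, add_comm n] using this
    simp only [hlog z hz] at h1
    refine tendsto_nhds_unique h1 (Tendsto.div_const (tendsto_const_nhds.add ?_) _)
    exact (Complex.continuous_re.tendsto _).comp (hunif.tendsto_at hz)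
  obtain ⟨r, hr, hball⟩ := Metric.isOpen_iff.1 hUo a ha
  have hΦs : ContDiffAt ℂ 2 Φ a :=
    (contDiffOn_of_uniformCauchySeqOn 2 (half_lt_self hr)
      (fun N => (ContDiffOn.sum fun k _ => hfs k).mono hball)
      (hunif.mono hball).uniformCauchySeqOn
      fun z hz => hunif.tendsto_at (hball hz)).contDiffAt
      (Metric.ball_mem_nhds a (half_pos hr))
  set y : C2 → ℂ := fun z => orbit g n z i with hy
  have hys : ContDiff ℂ ∞ y := (contDiff_piLp_apply (p := 2)).comp (contDiff_orbit hg n)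
  have hys' : ContDiffAt ℂ 2 y a := (contDiff_infty.1 hys 2).contDiffAt
  have hya : y a ≠ 0 := norm_pos_iff.1 (by linarith [ha.2])
  have hslit : y a / y a ∈ Complex.slitPlane := by
    rw [div_self hya]
    exact Complex.one_mem_slitPlane
  -- After division by `y a` the logarithm is taken near 1, where the principal branch is
  -- holomorphic; the constant `log ‖y a‖` compensates.
  refine ⟨fun z => (Complex.log (y z / y a) + Φ z) / ((d ^ n : ℝ) : ℂ),
    log ‖y a‖ / (d : ℝ) ^ n, ?_, ?_⟩
  · refine ContDiffAt.div_const (ContDiffAt.add ?_ hΦs) _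
    exact (Complex.contDiffAt_log hslit).comp a (hys'.div_const _)
  · filter_upwards [hUo.mem_nhds ha] with z hz
    have hyz : 0 < ‖y z‖ := by
      have := (hmem 0 z hz).2
      simp only [add_zero] at this
      simp only [hy]
      linarith
    rw [hGU z hz, Complex.div_ofReal_re, Complex.add_re, Complex.log_re, norm_div,
      log_div hyz.ne' (norm_ne_zero_iff.2 hya)]
    simp only [hy]
    ring

end IsGreen

end Sequence

/-! ### Hénon maps and their compositions are uniformly escaping. -/

theorem norm_eval_le_of_norm_coeff_le {q : ℂ[X]} {A S : ℝ} {y : ℂ} (hA : ∀ j, ‖q.coeff j‖ ≤ A)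
    (hS : 1 ≤ S) (hy : ‖y‖ ≤ S) : ‖q.eval y‖ ≤ (q.natDegree + 1) * A * S ^ q.natDegree := by
  have hA0 : 0 ≤ A := (norm_nonneg _).trans (hA 0)
  rw [Polynomial.eval_eq_sum_range]
  refine (norm_sum_le_of_le (f := fun j => q.coeff j * y ^ j)
    (n := fun _ => A * S ^ q.natDegree) _ fun j hj => ?_).trans_eq ?_
  · rw [norm_mul, norm_pow]
    have h1 : ‖y‖ ^ j ≤ S ^ q.natDegree :=
      (pow_le_pow_left₀ (norm_nonneg y) hy j).trans
        (pow_le_pow_right₀ hS (Nat.lt_succ_iff.1 (Finset.mem_range.1 hj)))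
    gcongr
    exact hA j
  · rw [Finset.sum_const, Finset.card_range, nsmul_eq_mul]
    push_cast
    ring

theorem norm_eval_sub_leadingCoeff_mul_pow_le {q : ℂ[X]} {A : ℝ} {y : ℂ} (hd : 1 ≤ q.natDegree)
    (hA : ∀ j, ‖q.coeff j‖ ≤ A) (hy : 1 ≤ ‖y‖) :
    ‖q.eval y - q.leadingCoeff * y ^ q.natDegree‖ ≤
      q.natDegree * A * ‖y‖ ^ (q.natDegree - 1) := by
  have hA0 : 0 ≤ A := (norm_nonneg _).trans (hA 0)
  rw [Polynomial.eval_eq_sum_range, Finset.sum_range_succ, Polynomial.leadingCoeff,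
    add_sub_cancel_right]
  refine (norm_sum_le_of_le (f := fun j => q.coeff j * y ^ j)
    (n := fun _ => A * ‖y‖ ^ (q.natDegree - 1)) _ fun j hj => ?_).trans_eq ?_
  · rw [norm_mul, norm_pow]
    have hj' := Finset.mem_range.1 hj
    have h1 : ‖y‖ ^ j ≤ ‖y‖ ^ (q.natDegree - 1) := pow_le_pow_right₀ hy (by lia)
    gcongr
    exact hA j
  · rw [Finset.sum_const, Finset.card_range, nsmul_eq_mul]
    ring

/-- Far out, the leading term dominates `q(y) - b x`. -/
theorem norm_eval_sub_mul_sub_le {q : ℂ[X]} {b x y : ℂ} {A R : ℝ} (hd : 2 ≤ q.natDegree)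
    (hA1 : 1 ≤ A) (hA : ∀ j, ‖q.coeff j‖ ≤ A) (hlc : 1 ≤ A * ‖q.leadingCoeff‖) (hb : ‖b‖ ≤ A)
    (hR : 2 * A ^ 2 * (q.natDegree + 1) ≤ R) (hy : R ≤ ‖y‖) (hx : ‖x‖ ≤ ‖y‖) :
    ‖q.eval y - b * x - q.leadingCoeff * y ^ q.natDegree‖ ≤
        ‖q.leadingCoeff * y ^ q.natDegree‖ / 2 ∧
      (2 * A + 1) * ‖y‖ ≤ ‖q.eval y - b * x‖ := by
  obtain ⟨e, he⟩ : ∃ e, q.natDegree = e + 2 := ⟨q.natDegree - 2, by lia⟩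
  have hAA : 1 ≤ A ^ 2 := one_le_pow₀ hA1
  have hdn : (0 : ℝ) ≤ q.natDegree := by positivity
  have hy1 : 1 ≤ ‖y‖ := by nlinarith
  have hlcy : 2 * A * (q.natDegree + 1) ≤ ‖q.leadingCoeff‖ * ‖y‖ := by
    have h1 : A * (2 * A * (q.natDegree + 1)) ≤ A * (‖q.leadingCoeff‖ * ‖y‖) := by
      calc A * (2 * A * (q.natDegree + 1)) = 2 * A ^ 2 * (q.natDegree + 1) := by ring
        _ ≤ 1 * ‖y‖ := by linarith
        _ ≤ A * ‖q.leadingCoeff‖ * ‖y‖ := by gcongr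
        _ = _ := by ring
    exact le_of_mul_le_mul_left h1 (by linarith)
  have hpow : ‖y‖ ≤ ‖y‖ ^ (e + 1) := le_self_pow₀ hy1 (by lia)
  have hmain : ‖q.leadingCoeff * y ^ q.natDegree‖ = ‖q.leadingCoeff‖ * ‖y‖ * ‖y‖ ^ (e + 1) := by
    rw [norm_mul, norm_pow, he]
    ring
  have h1 := norm_eval_sub_leadingCoeff_mul_pow_le (by lia) hA hy1
  have h2 : ‖b * x‖ ≤ A * ‖y‖ ^ (e + 1) := by
    rw [norm_mul]
    exact mul_le_mul hb (hx.trans hpow) (norm_nonneg _) (by linarith)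
  have he' : q.natDegree - 1 = e + 1 := by lia
  rw [he'] at h1
  have h3 : ‖q.eval y - b * x - q.leadingCoeff * y ^ q.natDegree‖ ≤
      (q.natDegree + 1) * A * ‖y‖ ^ (e + 1) := by
    have := norm_sub_le (q.eval y - q.leadingCoeff * y ^ q.natDegree) (b * x)
    rw [sub_right_comm] at this
    linarith
  have h4 : 2 * A * (q.natDegree + 1) * ‖y‖ ^ (e + 1) ≤
      ‖q.leadingCoeff * y ^ q.natDegree‖ := by
    rw [hmain]
    gcongr
  have h5 : ‖q.eval y - b * x - q.leadingCoeff * y ^ q.natDegree‖ ≤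
      ‖q.leadingCoeff * y ^ q.natDegree‖ / 2 := by linarith
  refine ⟨h5, ?_⟩
  have h6 := norm_sub_norm_le (q.leadingCoeff * y ^ q.natDegree) (q.eval y - b * x)
  rw [norm_sub_rev (q.leadingCoeff * y ^ q.natDegree)] at h6
  have h7 : (2 * A + 1) * ‖y‖ ≤ (q.natDegree + 1) * A * ‖y‖ ^ (e + 1) := by
    have h8 : (2 : ℝ) ≤ q.natDegree := by exact_mod_cast hd
    have h9 : 2 * A + 1 ≤ (q.natDegree + 1) * A := by nlinarith
    gcongr
  linarith

/-- Generalized Hénon maps with bounded coefficients, in the coordinates `y = z i` and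
`x = z i.rev`, are escaping. -/
theorem isEscaping_of_apply_eq {i : Fin 2} {A R : ℝ} {d : ℕ} {g : C2 → C2} {q : ℂ[X]} {b : ℂ}
    (hd : 2 ≤ d) (hq : q.natDegree = d) (hA1 : 1 ≤ A) (hA : ∀ j, ‖q.coeff j‖ ≤ A)
    (hlc : 1 ≤ A * ‖q.leadingCoeff‖) (hb : ‖b‖ ≤ A) (hR : 2 * A ^ 2 * (d + 1) ≤ R)
    (hgi : ∀ z, g z i = q.eval (z i) - b * z i.rev) (hgj : ∀ z, g z i.rev = z i) :
    IsEscaping i R ((d + 2) * A + 5) d g := by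
  subst hq
  have hAA : 1 ≤ A ^ 2 := one_le_pow₀ hA1
  have hdn : (2 : ℝ) ≤ q.natDegree := by exact_mod_cast hd
  have hR1 : 1 ≤ R := by nlinarith
  have hlc0 : q.leadingCoeff ≠ 0 := by
    rintro h
    rw [h, norm_zero, mul_zero] at hlc
    linarith
  have hlcpos : 0 < ‖q.leadingCoeff‖ := norm_pos_iff.2 hlc0
  have hci : ∀ j : Fin 2, ContDiff ℂ ∞ fun z : C2 => z j := fun j => contDiff_piLp_apply 2
  have hgis : ContDiff ℂ ∞ fun z : C2 => q.eval (z i) - b * z i.rev :=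
    ((by simpa using q.contDiff_aeval (R := ℂ) (𝕜 := ℂ) ∞ : ContDiff ℂ ∞ fun x => q.eval x).comp
      (hci i)).sub (contDiff_const.mul (hci i.rev))
  have key : ∀ z ∈ horn i R, _ := fun z hz =>
    norm_eval_sub_mul_sub_le hd hA1 hA hlc hb hR hz.2.le hz.1.le
  have hexp : ∀ z ∈ horn i R, 2 * ‖z i‖ ≤ ‖g z i‖ := fun z hz => by
    rw [hgi]
    refine le_trans ?_ (key z hz).2
    gcongr
    linarith
  have hne : ∀ z ∈ horn i R, q.leadingCoeff * z i ^ q.natDegree ≠ 0 := fun z hz =>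
    mul_ne_zero hlc0 (pow_ne_zero _ (norm_pos_iff.1 (by linarith [hz.2])))
  -- The relative error of the leading term. It is at most `1 / 2` on the horn, so `log (1 + s)` is
  -- holomorphic and bounded.
  set s : C2 → ℂ := fun z =>
    (q.eval (z i) - b * z i.rev - q.leadingCoeff * z i ^ q.natDegree) /
      (q.leadingCoeff * z i ^ q.natDegree) with hs
  have hs1 : ∀ z ∈ horn i R, ‖s z‖ ≤ 1 / 2 := fun z hz => by
    simp only [hs]
    rw [norm_div, div_le_iff₀ (norm_pos_iff.2 (hne z hz))]
    linarith [(key z hz).1]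
  have hslit : ∀ z ∈ horn i R, 1 + s z ∈ Complex.slitPlane := fun z hz =>
    Complex.mem_slitPlane_of_norm_lt_one ((hs1 z hz).trans_lt (by norm_num))
  refine ⟨?_, fun z hz => ⟨?_, ?_⟩, hexp,
    ⟨fun z => Complex.log q.leadingCoeff + Complex.log (1 + s z), ?_, fun z hz => ⟨?_, ?_⟩⟩,
    fun z => ?_, fun z hz => ?_⟩
  · rw [contDiff_piLp]
    intro j
    rcases (show ∀ i j : Fin 2, j = i ∨ j = i.rev by decide) i j with rfl | rfl
    · simpa only [hgi] using hgis
    · simpa only [hgj] using hci i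
  · rw [hgj]
    linarith [hexp z hz, hz.2]
  · linarith [hexp z hz, hz.2]
  · refine contDiffOn_const.add fun z hz => ?_
    refine ContDiffAt.contDiffWithinAt
      (ContDiffAt.comp (g := Complex.log) z (Complex.contDiffAt_log (hslit z hz)) ?_)
    have hm : ContDiff ℂ ∞ fun z : C2 => q.leadingCoeff * z i ^ q.natDegree :=
      contDiff_const.mul ((hci i).pow _)
    exact contDiffAt_const.add ((hgis.sub hm).contDiffAt.div hm.contDiffAt (hne z hz))
  · have h1 : ‖Complex.log (1 + s z)‖ ≤ 3 / 4 :=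
      (Complex.norm_log_one_add_half_le_self (hs1 z hz)).trans (by linarith [hs1 z hz])
    have h2 : ‖Complex.log q.leadingCoeff‖ ≤ A + 4 := by
      refine (Complex.norm_le_abs_re_add_abs_im _).trans ?_
      rw [Complex.log_re, Complex.log_im]
      have h3 := (Complex.abs_arg_le_pi q.leadingCoeff).trans pi_le_four
      have h4 : log ‖q.leadingCoeff‖ ≤ A :=
        (log_le_self hlcpos.le).trans (hA q.natDegree)
      have h5 : 0 ≤ log A + log ‖q.leadingCoeff‖ := by
        rw [← log_mul (by linarith) hlcpos.ne']
        exact log_nonneg hlc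
      have h6 := log_le_sub_one_of_pos (show 0 < A by linarith)
      have h7 : |log ‖q.leadingCoeff‖| ≤ A := abs_le.2 ⟨by linarith, h4⟩
      linarith
    have h8 := norm_add_le (Complex.log q.leadingCoeff) (Complex.log (1 + s z))
    nlinarith
  · have h1 := hne z hz
    rw [hgi, Complex.exp_add, Complex.exp_log hlc0,
      Complex.exp_log (Complex.slitPlane_ne_zero (hslit z hz))]
    simp only [hs]
    rw [one_add_div h1, add_sub_cancel, mul_div_assoc', mul_div_assoc', eq_div_iff h1]
    ring
  · have hS := hR1.trans (le_size R z)
    set S := size R z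
    have hSd : S ≤ S ^ q.natDegree := le_self_pow₀ hS (by lia)
    have hle : S ≤ ((q.natDegree + 2) * A + 5) * S ^ q.natDegree := by
      refine hSd.trans (le_mul_of_one_le_left (by linarith) ?_)
      nlinarith
    refine (size_le_iff i).2 ⟨(le_size R z).trans hle, ?_, ?_⟩
    · rw [hgj]
      exact (norm_apply_le_size R z i).trans hle
    · rw [hgi]
      have h1 := norm_eval_le_of_norm_coeff_le hA hS (norm_apply_le_size R z i)
      have h2 : ‖b * z i.rev‖ ≤ A * S ^ q.natDegree := by
        rw [norm_mul]
        exact mul_le_mul hb ((norm_apply_le_size R z i.rev).trans hSd) (norm_nonneg _) (by linarith)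
      have h3 := norm_sub_le (q.eval (z i)) (b * z i.rev)
      linarith
  · rw [size_le_iff i, hgj]
    refine ⟨le_max_left _ _, ?_⟩
    have hnot : R < ‖g z i‖ → ‖g z i‖ ≤ ‖z i‖ := fun h => by
      by_contra! h'
      exact hz ⟨by rwa [hgj], h⟩
    suffices h : R < ‖z i‖ → ‖g z i‖ ≤ ‖z i‖ → ‖z i‖ ≤ size R z / 2 by
      rcases le_or_gt ‖g z i‖ R with h1 | h1 <;> rcases le_or_gt ‖z i‖ R with h2 | h2
      · exact ⟨le_max_of_le_left h2, le_max_of_le_left h1⟩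
      · exact ⟨le_max_of_le_right (h h2 (by linarith)), le_max_of_le_left h1⟩
      · linarith [hnot h1]
      · have := h h2 (hnot h1)
        exact ⟨le_max_of_le_right this, le_max_of_le_right ((hnot h1).trans this)⟩
    intro h1 h2
    -- Here `|q (z i)| ≥ (2A + 1) |z i|` but `|g z i| ≤ |z i|`, so `b * z i.rev` must cancel at
    -- least `2A |z i|`. As it is at most `A * size R z`, the halving follows.
    have h3 := (norm_eval_sub_mul_sub_le (x := 0) hd hA1 hA hlc hb hR h1.le (by simp)).2
    rw [mul_zero, sub_zero] at h3
    rw [hgi] at h2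
    have h4 := norm_sub_norm_le (q.eval (z i)) (b * z i.rev)
    have h5 : ‖b * z i.rev‖ ≤ A * size R z := by
      rw [norm_mul]
      exact mul_le_mul hb (norm_apply_le_size R z i.rev) (norm_nonneg _) (by linarith)
    nlinarith

/-- The members of a family of maps are escaping, with uniform constants. -/
def IsUniformlyEscaping {M : Type*} (i : Fin 2) (d : ℕ) (g : M → C2 → C2) : Prop :=
  ∃ R₀, ∀ R ≥ R₀, ∃ C, ∀ l, IsEscaping i R C d (g l)

/-- Both families must share one horn, which is why every `R` beyond a threshold is admitted. -/
theorem IsUniformlyEscaping.comp {M : Type*} {i : Fin 2} {d d' : ℕ} {g g' : M → C2 → C2}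
    (hg' : IsUniformlyEscaping i d' g') (hg : IsUniformlyEscaping i d g) :
    IsUniformlyEscaping i (d * d') fun l => g' l ∘ g l := by
  obtain ⟨R₀, h⟩ := hg
  obtain ⟨R₁, h'⟩ := hg'
  refine ⟨max 1 (max R₀ R₁), fun R hR => ?_⟩
  simp only [ge_iff_le, max_le_iff] at hR
  obtain ⟨C, hC⟩ := h R hR.2.1
  obtain ⟨C', hC'⟩ := h' R hR.2.2
  exact ⟨_, fun l => (hC' l).comp hR.1 (hC l)⟩

theorem isUniformlyEscaping_of_continuous {M : Type*} [TopologicalSpace M] [CompactSpace M]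
    {i : Fin 2} {d : ℕ} {g : M → C2 → C2} {q : M → ℂ[X]} {b : M → ℂ} (hd : 2 ≤ d)
    (hq : ∀ l, (q l).natDegree = d) (hqc : ∀ j, Continuous fun l => (q l).coeff j)
    (hb : Continuous b) (hgi : ∀ l z, g l z i = (q l).eval (z i) - b l * z i.rev)
    (hgj : ∀ l z, g l z i.rev = z i) : IsUniformlyEscaping i d g := by
  have hlc : ∀ l, (q l).coeff d ≠ 0 := fun l h => by
    rw [← hq l, Polynomial.coeff_natDegree, Polynomial.leadingCoeff_eq_zero] at h
    have := hq l
    rw [h, Polynomial.natDegree_zero] at this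
    lia
  set S : M → ℝ := fun l =>
    ∑ j ∈ Finset.range (d + 1), ‖(q l).coeff j‖ + ‖((q l).coeff d)⁻¹‖ + ‖b l‖ with hS
  have hSc : Continuous S :=
    ((continuous_finsetSum _ fun j _ => (hqc j).norm).add ((hqc d).inv₀ hlc).norm).add hb.norm
  obtain ⟨A, hA⟩ := isCompact_univ.exists_bound_of_continuousOn hSc.continuousOn
  have hsum : ∀ l, 0 ≤ ∑ j ∈ Finset.range (d + 1), ‖(q l).coeff j‖ := fun l =>
    Finset.sum_nonneg fun j _ => norm_nonneg _
  have hle : ∀ l, S l ≤ max 1 A := fun l =>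
    (le_abs_self _).trans ((hA l (Set.mem_univ l)).trans (le_max_right _ _))
  refine ⟨2 * max 1 A ^ 2 * (d + 1), fun R hR => ⟨_, fun l => isEscaping_of_apply_eq (b := b l) hd
    (hq l) (le_max_left 1 A) (fun j => ?_) ?_ ?_ hR (hgi l) (hgj l)⟩⟩
  · refine le_trans ?_ (hle l)
    have h1 : ‖(q l).coeff j‖ ≤ ∑ j ∈ Finset.range (d + 1), ‖(q l).coeff j‖ := by
      rcases le_or_gt j d with hj | hj
      · exact Finset.single_le_sum (f := fun j => ‖(q l).coeff j‖) (fun _ _ => norm_nonneg _)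
          (Finset.mem_range.2 (by lia))
      · rw [Polynomial.coeff_eq_zero_of_natDegree_lt (by rw [hq l]; exact hj), norm_zero]
        exact hsum l
    linarith [norm_nonneg ((q l).coeff d)⁻¹, norm_nonneg (b l)]
  · rw [Polynomial.leadingCoeff, hq l]
    have h1 : ‖(q l).coeff d‖⁻¹ ≤ max 1 A := by
      rw [← norm_inv]
      linarith [hle l, hsum l, norm_nonneg (b l)]
    exact (inv_le_iff_one_le_mul₀ (norm_pos_iff.2 (hlc l))).1 h1
  · linarith [hle l, hsum l, norm_nonneg ((q l).coeff d)⁻¹]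

/-- The index of the coordinate that dominates the forward or the backward orbits of Hénon maps. -/
def dominantIndex (ε : ℤˣ) : Fin 2 := if ε = 1 then 1 else 0

theorem isUniformlyEscaping_composeAll {M : Type*} {i : Fin 2} (ε : ℤˣ) {m : ℕ} (hm : 1 ≤ m)
    {deg : Fin m → ℕ} {f : M → Fin m → Equiv.Perm C2}
    (h : ∀ j, IsUniformlyEscaping i (deg j) fun l => ⇑(f l j ^ (ε : ℤ))) :
    IsUniformlyEscaping i (∏ j, deg j) fun l => ⇑(composeAll m (f l) ^ (ε : ℤ)) := by
  -- The empty composition is excluded: the identity does not double the dominant coordinate.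
  induction m, hm using Nat.le_induction with
  | base => simpa [composeAll] using h 0
  | succ m hm ih =>
    have h1 := ih (f := fun l j => f l j.castSucc) fun j => h j.castSucc
    have h2 := h (Fin.last m)
    rw [Fin.prod_univ_castSucc]
    rcases Int.units_eq_one_or ε with rfl | rfl
    · simpa [composeAll, Function.comp_def] using h2.comp h1
    -- Inversion reverses the order of composition, hence also that of the degrees.
    · simpa [composeAll, Function.comp_def, mul_comm] using h1.comp h2

theorem continuous_composeAll {M : Type*} [TopologicalSpace M] (ε : ℤˣ) {m : ℕ}
    {f : M → Fin m → Equiv.Perm C2}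
    (h : ∀ j, Continuous fun x : M × C2 => (f x.1 j ^ (ε : ℤ)) x.2) :
    Continuous fun x : M × C2 => (composeAll m (f x.1) ^ (ε : ℤ)) x.2 := by
  induction m with
  | zero => simpa [composeAll] using continuous_snd
  | succ m ih =>
    have h1 := ih (f := fun l j => f l j.castSucc) fun j => h j.castSucc
    have h2 := h (Fin.last m)
    rcases Int.units_eq_one_or ε with rfl | rfl
    · simpa [composeAll, Function.comp_def] using h2.comp (continuous_fst.prodMk h1)
    · simpa [composeAll, Function.comp_def] using h1.comp (continuous_fst.prodMk h2)

theorem continuous_eval_of_continuous_coeff {M Y : Type*} [TopologicalSpace M] [TopologicalSpace Y]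
    {q : M → ℂ[X]} {d : ℕ} (hq : ∀ l, (q l).natDegree = d)
    (hqc : ∀ j, Continuous fun l => (q l).coeff j) {s : Y → M} {t : Y → ℂ} (hs : Continuous s)
    (ht : Continuous t) : Continuous fun x => (q (s x)).eval (t x) := by
  simp only [Polynomial.eval_eq_sum_range, hq]
  exact continuous_finsetSum _ fun j _ => ((hqc j).comp hs).mul (ht.pow j)

theorem continuous_C2_iff {Y : Type*} [TopologicalSpace Y] {f : Y → C2} :
    Continuous f ↔ Continuous (fun x => f x 0) ∧ Continuous fun x => f x 1 := by
  refine ⟨fun h => ⟨by fun_prop, by fun_prop⟩, fun h => ?_⟩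
  refine (PiLp.continuous_toLp 2 _).comp (g := fun v => WithLp.toLp 2 v)
    (f := fun x => (f x).ofLp) (continuous_pi fun j => ?_)
  fin_cases j
  exacts [h.1, h.2]

/-! ### The random iterates of a Hénon family. -/

namespace HenonFamily

variable {M : Type*} [TopologicalSpace M] {m : ℕ} (F : HenonFamily M m)

theorem isUniformlyEscaping_map [CompactSpace M] (hm : 1 ≤ m) (ε : ℤˣ) :
    IsUniformlyEscaping (dominantIndex ε) F.degree fun l => ⇑(F.map l ^ (ε : ℤ)) := by
  refine isUniformlyEscaping_composeAll ε hm fun j => ?_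
  rcases Int.units_eq_one_or ε with rfl | rfl
  · refine isUniformlyEscaping_of_continuous (q := F.p j) (b := F.a j) (F.two_le_deg j)
      (F.natDegree_eq j) (F.continuous_coeff j) (F.continuous_a j) (fun l z => ?_) fun l z => ?_
    · simp [dominantIndex, henonMap]
    · simp [dominantIndex, henonMap]
  · have hinv := (F.continuous_a j).inv₀ (F.a_ne_zero j)
    have hi : dominantIndex (-1) = 0 := by decide
    rw [hi]
    -- The polynomial of the inverse is not monic; this is why general leading coefficients were
    -- allowed.
    refine isUniformlyEscaping_of_continuous (q := fun l => Polynomial.C (F.a j l)⁻¹ * F.p j l)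
      (b := fun l => (F.a j l)⁻¹) (F.two_le_deg j) (fun l => ?_) (fun k => ?_) hinv
      (fun l z => ?_) fun l z => ?_
    · rw [Polynomial.natDegree_C_mul (inv_ne_zero (F.a_ne_zero j l)), F.natDegree_eq]
    · simpa [Polynomial.coeff_C_mul] using! hinv.mul (F.continuous_coeff j k)
    · simp [henonMap, Equiv.Perm.inv_def, Equiv.symm]
      ring
    · simp [henonMap, Equiv.Perm.inv_def, Equiv.symm]

theorem continuous_map (ε : ℤˣ) : Continuous fun x : M × C2 => (F.map x.1 ^ (ε : ℤ)) x.2 := by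
  refine continuous_composeAll
    (f := fun l j => henonMap (F.p j l) (F.a j l) (F.a_ne_zero j l)) ε fun j => ?_
  have h0 : Continuous fun x : M × C2 => x.2 0 := by fun_prop
  have h1 : Continuous fun x : M × C2 => x.2 1 := by fun_prop
  have ha := (F.continuous_a j).comp (continuous_fst (X := M) (Y := C2))
  have hev : ∀ {t : M × C2 → ℂ}, Continuous t → Continuous fun x => (F.p j x.1).eval (t x) :=
    fun ht => continuous_eval_of_continuous_coeff (F.natDegree_eq j) (F.continuous_coeff j)
      continuous_fst ht
  rw [continuous_C2_iff]
  rcases Int.units_eq_one_or ε with rfl | rfl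
  · simpa [henonMap] using ⟨h1, (hev h1).sub (ha.mul h0)⟩
  · simpa [henonMap, Equiv.Perm.inv_def, Equiv.symm] using
      ⟨((hev h0).sub h1).div ha fun x => F.a_ne_zero j x.1, h0⟩

end HenonFamily

namespace HenonFamily

variable {M : Type*} [TopologicalSpace M] {m : ℕ} (F : HenonFamily M m)

theorem iter_eq_orbit (ε : ℤˣ) (L : ℕ → M) (n : ℕ) (z : C2) :
    F.iter ε L n z = orbit (fun n => ⇑(F.map (L n) ^ (ε : ℤ))) n z := by
  induction n with
  | zero => rfl
  | succ n ih => rw [orbit_succ, ← ih]; rfl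

theorem iter_succ_prependParam (ε : ℤˣ) (l : M) (L : ℕ → M) (n : ℕ) :
    F.iter ε (prependParam l L) (n + 1) = F.iter ε L n * F.map l ^ (ε : ℤ) := by
  induction n with
  | zero => simp [iter, prependParam]
  | succ n ih => rw [iter, ih, iter, mul_assoc]; rfl

theorem continuous_iter (ε : ℤˣ) (n : ℕ) :
    Continuous fun x : (ℕ → M) × C2 => F.iter ε x.1 n x.2 := by
  induction n with
  | zero => exact continuous_snd
  | succ n ih =>
    exact (F.continuous_map ε).comp (((continuous_apply n).comp continuous_fst).prodMk ih)

theorem continuous_greenApprox (ε : ℤˣ) (n : ℕ) :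
    Continuous fun x : (ℕ → M) × C2 => F.greenApprox ε x.1 n x.2 :=
  continuous_const.mul (continuous_posLog.comp (F.continuous_iter ε n).norm)

theorem two_le_degree (hm : 1 ≤ m) : 2 ≤ F.degree := by
  refine (F.two_le_deg ⟨0, hm⟩).trans (Nat.le_of_dvd ?_ (Finset.dvd_prod_of_mem _ (by simp)))
  exact Finset.prod_pos fun j _ => by linarith [F.two_le_deg j]

/-- The defining property of the Green functions passes to the sequence with a parameter
prepended. -/
theorem apply_map_eq_degree_mul (hm : 1 ≤ m) {ε : ℤˣ} {l : M} {L : ℕ → M} {z : C2} {s t : ℝ}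
    (hs : Tendsto (fun n => F.greenApprox ε L n ((F.map l ^ (ε : ℤ)) z)) atTop (𝓝 s))
    (ht : Tendsto (fun n => F.greenApprox ε (prependParam l L) n z) atTop (𝓝 t)) :
    s = F.degree * t := by
  refine tendsto_nhds_unique hs ?_
  have h := (ht.comp (tendsto_add_atTop_nat 1)).const_mul (F.degree : ℝ)
  refine h.congr fun n => ?_
  have hd : (F.degree : ℝ) ≠ 0 := by
    have := F.two_le_degree hm
    positivity
  simp only [Function.comp_apply, greenApprox, iter_succ_prependParam, Equiv.Perm.mul_apply]
  rw [pow_succ]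
  field_simp

end HenonFamily

theorem proposition1p1 {k m : ℕ} (hm : 1 ≤ m) (M : Set (Fin k → ℂ)) (hM : IsCompact M)
    (F : HenonFamily M m) (ε : ℤˣ) :
    ∃ G : (ℕ → M) → C(C2, ℝ),
      -- locally uniform convergence to a Hölder continuous plurisubharmonic function
      (∀ L : ℕ → M,
        TendstoLocallyUniformly (fun n => F.greenApprox ε L n) (G L) atTop ∧
        (∀ z, 0 ≤ G L z) ∧ IsLocallyHolder (G L) ∧ IsPlurisubharmonic (G L)) ∧
      -- invariance
      (∀ (l : M) (L : ℕ → M) (z : C2),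
        G L ((F.map l ^ (ε : ℤ)) z) = F.degree * G (prependParam l L) z) ∧
      -- behaviour on the escaping set and on its complement
      (∀ L : ℕ → M,
        F.escapingSet ε L = (F.boundedSet ε L)ᶜ ∧
        (∀ z ∈ F.escapingSet ε L, 0 < G L z) ∧
        IsPluriharmonicOn (G L) (F.escapingSet ε L) ∧
        (∀ z, G L z = 0 ↔ z ∈ F.boundedSet ε L)) ∧
      -- uniform logarithmic growth
      (∃ C : ℝ, 0 < C ∧ ∀ (L : ℕ → M) (z : C2), 0 ≤ G L z ∧ G L z ≤ log⁺ ‖z‖ + C) ∧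
      -- continuity in the parameter sequence, for the product topology and the topology of
      -- locally uniform convergence
      Continuous G := by
  have : CompactSpace M := isCompact_iff_compactSpace.1 hM
  have hd := F.two_le_degree hm
  obtain ⟨R₀, hR₀⟩ := F.isUniformlyEscaping_map hm ε
  obtain ⟨C, hC⟩ := hR₀ (max 1 R₀) (le_max_right _ _)
  set R := max 1 R₀
  have hR : 1 ≤ R := le_max_left _ _
  set g : (ℕ → M) → ℕ → C2 → C2 := fun L n => ⇑(F.map (L n) ^ (ε : ℤ)) with hgdef
  have hg : ∀ L n, IsEscaping (dominantIndex ε) R C F.degree (g L n) := fun L n => hC (L n)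
  choose G hG using fun L => exists_isGreen hR hd (hg L)
  have happ : ∀ L n z,
      F.greenApprox ε L n z = 1 / (F.degree : ℝ) ^ n * log⁺ ‖orbit (g L) n z‖ := fun L n z => by
    rw [HenonFamily.greenApprox, F.iter_eq_orbit]
  -- The error bound does not involve the parameter sequence, so convergence is locally uniform on
  -- the product.
  have hjoint : Continuous fun x : (ℕ → M) × C2 => G x.1 x.2 := by
    have h : TendstoLocallyUniformly (fun n (x : (ℕ → M) × C2) => F.greenApprox ε x.1 n x.2)
        (fun x => G x.1 x.2) atTop :=
      tendstoLocallyUniformly_of_size_le hR hd (C := C) (s := Prod.snd) continuous_snd fun n x => by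
        rw [happ]
        exact hG x.1 n x.2
    exact h.continuous (Frequently.of_forall (F.continuous_greenApprox ε))
  have hloc : ∀ L, TendstoLocallyUniformly (fun n => F.greenApprox ε L n) (G L) atTop := fun L => by
    refine tendstoLocallyUniformly_of_size_le hR hd (C := C) continuous_id fun n z => ?_
    rw [happ]
    exact hG L n z
  have hesc : ∀ L z, z ∈ F.escapingSet ε L ↔ ∃ n, orbit (g L) n z ∈ horn (dominantIndex ε) R := by
    intro L z
    rw [← tendsto_norm_orbit_iff hR (hg L)]
    simp only [HenonFamily.escapingSet, Set.mem_ofPred_eq, F.iter_eq_orbit, hgdef]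
  have hbdd : ∀ L z, z ∈ F.boundedSet ε L ↔ ∀ n, orbit (g L) n z ∉ horn (dominantIndex ε) R := by
    intro L z
    rw [← isBounded_range_orbit_iff hR (hg L)]
    simp only [HenonFamily.boundedSet, Set.mem_ofPred_eq, F.iter_eq_orbit, hgdef]
  have hpos : ∀ L, ∀ z ∈ F.escapingSet ε L, 0 < G L z := fun L z hz => by
    obtain ⟨n, hn⟩ := (hesc L z).1 hz
    exact (hG L).pos_of_mem_horn hR hd (hg L) hn
  have hcompl : ∀ L, F.escapingSet ε L = (F.boundedSet ε L)ᶜ := fun L => by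
    ext z
    rw [Set.mem_compl_iff, hesc, hbdd]
    push Not
    rfl
  -- Currying a jointly continuous function is continuous into the compact-open topology, that of
  -- locally uniform convergence.
  refine ⟨ContinuousMap.curry ⟨fun x : (ℕ → M) × C2 => G x.1 x.2, hjoint⟩,
    fun L => ⟨hloc L, (hG L).nonneg hd, (hG L).isLocallyHolder hR hd (hg L), ?_⟩,
    fun l L z => ?_, fun L => ⟨hcompl L, hpos L, ?_, fun z => ⟨fun h => ?_, fun h => ?_⟩⟩,
    ?_, ContinuousMap.continuous _⟩
  · refine IsPlurisubharmonic.of_tendstoLocallyUniformly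
      (fun n => (F.continuous_greenApprox ε n).comp (Continuous.prodMk_right L)) (hloc L)
      fun n a b => ?_
    have hline : Differentiable ℂ fun ζ : ℂ => a + ζ • b := by fun_prop
    have h := posLog_norm_le_circleAverage
      (((contDiff_orbit (hg L) n).differentiable (by simp)).comp hline)
    simp only [Function.comp_apply, zero_smul, add_zero] at h
    simp only [Function.comp_apply, happ, ← smul_eq_mul]
    rw [circleAverage_fun_smul]
    exact smul_le_smul_of_nonneg_left h (by positivity)
  · exact F.apply_map_eq_degree_mul hm
      ((hloc L).tendstoLocallyUniformlyOn (s := Set.univ) |>.tendsto_at (Set.mem_univ _))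
      ((hloc _).tendstoLocallyUniformlyOn (s := Set.univ) |>.tendsto_at (Set.mem_univ _))
  · refine IsPluriharmonicOn.of_eventuallyEq_re fun a ha => ?_
    obtain ⟨n, hn⟩ := (hesc L a).1 ha
    exact (hG L).exists_eventuallyEq_re hR hd (hg L) hn
  · by_contra hz
    exact (hpos L z ((hcompl L).symm ▸ hz)).ne' h
  · exact (hG L).eq_zero_of_notMem_horn hR hd (hg L) ((hbdd L z).1 h)
  · refine ⟨max 1 (log R + C + log 2), by positivity, fun L z => ⟨(hG L).nonneg hd z, ?_⟩⟩
    refine ((hG L).le_posLog_add hR hd (hg L) z).trans ?_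
    gcongr
    exact le_max_right _ _
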